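/- Let $C$ be a commutative noetherian domain and let $I\lhd C$ be a prime ideal. Let $G$ be a polycyclic-by-finite group acting on $C$ by ring automorphisms, written $c\mapsto c^g$ with $c^{gh}=(c^h)^g$, and put $I^g=\{c^g : c\in I\}$ and $K=\operatorname{Stab}_G(I)=\{g\in G : I^g=I\}$. Let $B=C\# G$ be the skew group ring, that is, the free left $C$-module on $G$ with multiplication $(rh)(sg)=(rs^h)(hg)$ for $r,s\in C$ and $g,h\in G$, and let $R=\{b\in B : b\,IB\subseteq IB\}$ be the idealiser in $B$ of the right ideal $IB$. Call a subgroup $H\le G$ complementary to $K$ if $H\cap K=\{1\}$ and the product set $HK$ is a subgroup of finite index in $G$. Suppose that $K$ has at least one complementary subgroup. Then the following are equivalent: 1. there exists a subgroup $H\le G$, complementary to $K$, such that $\{a\in H : \operatorname{Tor}_1^C(C/I^{a^{-1}},C/J)\neq 0\}$ is finite for all prime ideals $J\lhd C$; 2. $R$ is left noetherian; 3. for all subgroups $H\le G$ complementary to $K$, the set $\{a\in H : \operatorname{Tor}_1^C(C/I^{a^{-1}},C/J)\neq 0\}$ is finite for all prime ideals $J\lhd C$. -/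

import Mathlib

open CategoryTheory CategoryTheory.Limits
open scoped Pointwise

/-- A group `G` is polycyclic if it has a finite series
`1 = s 0 ≤ s 1 ≤ ⋯ ≤ s n = G` of subgroups, each normal in the next one,
with cyclic factors `s (i + 1) / s i`. -/
def IsPolycyclic (G : Type*) [Group G] : Prop :=
  ∃ (n : ℕ) (s : ℕ → Subgroup G), s 0 = ⊥ ∧ s n = ⊤ ∧
    ∀ i < n, s i ≤ s (i + 1) ∧
      ∃ _ : ((s i).subgroupOf (s (i + 1))).Normal,
        IsCyclic (↥(s (i + 1)) ⧸ (s i).subgroupOf (s (i + 1)))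

/-- A group is polycyclic-by-finite if it has a normal polycyclic subgroup of finite index. -/
def IsPolycyclicByFinite (G : Type*) [Group G] : Prop :=
  ∃ N : Subgroup G, N.Normal ∧ N.FiniteIndex ∧ IsPolycyclic N

/-- `H` is complementary to `K` if `H ∩ K` is trivial and the product set `HK` is a subgroup
of finite index in `G`. -/
def IsComplementary {G : Type*} [Group G] (H K : Subgroup G) : Prop :=
  H ⊓ K = ⊥ ∧ ∃ L : Subgroup G, (L : Set G) = (H : Set G) * (K : Set G) ∧ L.FiniteIndex

/-- The idealiser `{b ∈ B | b L ⊆ L}` of a right ideal `L` of a ring `B`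
(right ideals are submodules of `B` over the opposite ring). -/
def idealiser {B : Type*} [Ring B] (L : Submodule Bᵐᵒᵖ B) : Subring B where
  carrier := {b | ∀ x ∈ L, b * x ∈ L}
  mul_mem' {a b} ha hb x hx := by
    rw [mul_assoc]
    exact ha _ (hb _ hx)
  one_mem' x hx := by rwa [one_mul]
  add_mem' {a b} ha hb x hx := by
    rw [add_mul]
    exact L.add_mem (ha _ hx) (hb _ hx)
  zero_mem' x _ := by
    rw [zero_mul]
    exact L.zero_mem
  neg_mem' {a} ha x hx := by
    rw [neg_mul]
    exact L.neg_mem (ha _ hx)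

/-- The skew group ring `C # G`: free as a left `C`-module on the elements of `G`, with
multiplication `(r h) (s g) = (r s^h) (h g)`, where `s^h = h • s`. -/
abbrev SkewGroupRing (C G : Type*) [CommRing C] [Group G] [MulSemiringAction G C] : Type _ :=
  SkewMonoidAlgebra C G

/-- The right ideal `I B` of the skew group ring `B = C # G` generated by an ideal `I` of `C`,
with `C` embedded in `B` by `c ↦ c 1`. -/
noncomputable def extendedRightIdeal {C : Type*} (G : Type*) [CommRing C] [Group G]
    [MulSemiringAction G C] (I : Ideal C) :
    Submodule (SkewGroupRing C G)ᵐᵒᵖ (SkewGroupRing C G) :=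
  Submodule.span (SkewGroupRing C G)ᵐᵒᵖ
    ((fun c : C => (SkewMonoidAlgebra.single (1 : G) c : SkewGroupRing C G)) '' (I : Set C))

/-- The `C`-module `Tor₁^C(C/I, C/J)`. -/
noncomputable def torOne {C : Type*} [CommRing C] (I J : Ideal C) : ModuleCat C :=
  ((Tor (ModuleCat C) 1).obj (ModuleCat.of C (C ⧸ I))).obj (ModuleCat.of C (C ⧸ J))

/-- The set `{a ∈ H | Tor₁^C(C/I^(a⁻¹), C/J) ≠ 0}`, where `I^g = g • I` is the image of the
ideal `I` under the action of `g`. -/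
def torSet {C G : Type*} [CommRing C] [Group G] [MulSemiringAction G C]
    (H : Subgroup G) (I J : Ideal C) : Set G :=
  {a | a ∈ H ∧ ¬ IsZero (torOne (a⁻¹ • I) J)}

/-! View elements of `B` as coefficient functions `G →₀ C`, with `g` acting by `act g`. Two
translations carry the proof: Tor₁(C/I, C/J) vanishes exactly when I ∩ J = IJ (`isZero_torOne_iff`),
and, `I` being prime, `R` consists of the elements whose coefficients outside `K` lie in `I`
(`mem_idealiser`).

From 2 to 3: the functions with coefficient at `h` in I ∩ hJ form a left ideal of `R`. Modulo
coefficients in I·hJ, the ring `R` moves `h` only inside `Kh`. Finite generation therefore confines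
the `h` with I ∩ hJ ≠ I·hJ to finitely many cosets of `K`, each of which meets `H` at most once.

From 1 to 2: prime filtrations and the finite index of `HK` give condition (*): for every ideal `J`,
the `g` with I ∩ gJ ≠ I·gJ lie in finitely many cosets `Kf` (`exists_finite_of_isComplementary`).
Let `P` be the coefficients of a left ideal of `R` and L = BP. The restriction of `P` to `K` is a
left ideal of C#K, finitely generated by `Hilbert`; the remainder P ∩ IB lies between IL and L ∩ IB.
It is thus enough that (L ∩ IB)/IL be noetherian over `K`, which is `RelNoeth`.

That is proved along a series of subgroups, for K ∩ S acting on `S`-stable `L`. Finite-index steps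
are immediate. In an infinite cyclic step from S' to S with K ∩ S ⊄ S', an element of K ∩ S shifts
degrees and the leading-coefficient argument of Hilbert's basis theorem applies (`RelNoeth.of_mem`).
If K ∩ S ≤ S', the obstruction to reducing degree n modulo IL sits on translates by tⁿs of finitely
many ideals (`Vanish`); a coset `Kf` accounts for only one n, so (*) leaves a bounded window of
degrees, treated by S' (`RelNoeth.of_star`). -/

namespace SkewIdealiser

/-! ### Coefficient functions and their restrictions. -/

section Coefficients

variable {C G : Type*} [CommRing C]

/-- Elements all of whose coefficients lie in an ideal. -/
def coeffIn (b : Ideal C) : Submodule C (G →₀ C) where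
  carrier := {f | ∀ x, f x ∈ b}
  add_mem' hf hf' x := b.add_mem (hf x) (hf' x)
  zero_mem' _ := b.zero_mem
  smul_mem' c _ hf x := b.mul_mem_left c (hf x)

theorem smul_le_coeffIn (a : Ideal C) (N : Submodule C (G →₀ C)) : a • N ≤ coeffIn a :=
  Submodule.smul_le.2 fun _ hr n _ x => a.mul_mem_right (n x) hr

open Classical in
/-- Restriction of coefficient functions to a subset. -/
noncomputable def res (A : Set G) : (G →₀ C) →ₗ[C] (G →₀ C) where
  toFun f := f.filter (· ∈ A)
  map_add' _ _ := Finsupp.filter_add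
  map_smul' _ _ := Finsupp.filter_smul

open Classical in
theorem res_apply (A : Set G) (f : G →₀ C) (x : G) : res A f x = if x ∈ A then f x else 0 :=
  Finsupp.filter_apply _ _ _

theorem res_mem_supported (A : Set G) (f : G →₀ C) : res A f ∈ Finsupp.supported C C A := by
  rw [Finsupp.mem_supported']
  intro x hx
  simp [res_apply, hx]

theorem res_mem_coeffIn {b : Ideal C} (A : Set G) {f : G →₀ C} (hf : f ∈ coeffIn b) :
    res A f ∈ coeffIn b := fun x => by
  rw [res_apply]
  split_ifs
  exacts [hf x, b.zero_mem]

end Coefficients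

/-! ### The semilinear group action and stable submodules. -/

section Twisted

variable {C G : Type*} [CommRing C] [Group G] [MulSemiringAction G C]

/-- Left multiplication by the group element `g` on the skew group ring, seen on coefficient
functions. -/
noncomputable def act (g : G) : (G →₀ C) →+ (G →₀ C) where
  toFun f := Finsupp.equivMapDomain (Equiv.mulLeft g)
    (f.mapRange (fun c : C => g • c) (smul_zero g))
  map_zero' := by ext x; simp
  map_add' f f' := by ext x; simp

@[simp]
theorem act_apply (g : G) (f : G →₀ C) (x : G) : act g f x = g • f (g⁻¹ * x) := by
  simp [act]

@[simp]
theorem act_one (f : G →₀ C) : act 1 f = f := by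
  ext x; simp

theorem act_act (g h : G) (f : G →₀ C) : act g (act h f) = act (g * h) f := by
  ext x; simp [mul_smul, mul_assoc]

theorem act_smul (g : G) (c : C) (f : G →₀ C) : act g (c • f) = (g • c) • act g f := by
  ext x; simp [smul_mul']

/-- A submodule stable under the action of the elements of a subgroup. -/
def Stable (S : Subgroup G) (N : Submodule C (G →₀ C)) : Prop :=
  ∀ s ∈ S, ∀ x ∈ N, act s x ∈ N

theorem Stable.mono {S T : Subgroup G} (h : S ≤ T) {N : Submodule C (G →₀ C)}
    (hN : Stable T N) : Stable S N :=
  fun s hs => hN s (h hs)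

theorem Stable.inf {S : Subgroup G} {N N' : Submodule C (G →₀ C)} (h : Stable S N)
    (h' : Stable S N') : Stable S (N ⊓ N') :=
  fun s hs x hx => ⟨h s hs x hx.1, h' s hs x hx.2⟩

theorem Stable.sup {S : Subgroup G} {N N' : Submodule C (G →₀ C)} (h : Stable S N)
    (h' : Stable S N') : Stable S (N ⊔ N') := by
  intro s hs x hx
  obtain ⟨y, hy, z, hz, rfl⟩ := Submodule.mem_sup.1 hx
  rw [map_add]
  exact Submodule.add_mem_sup (h s hs y hy) (h' s hs z hz)

/-- The submodule generated by a set under scalars and the elements of a subgroup. -/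
noncomputable def gen (S : Subgroup G) (X : Set (G →₀ C)) : Submodule C (G →₀ C) :=
  Submodule.span C (Set.image2 (fun s x => act s x) (S : Set G) X)

theorem act_mem_gen {S : Subgroup G} {X : Set (G →₀ C)} {s : G} (hs : s ∈ S) {x : G →₀ C}
    (hx : x ∈ X) : act s x ∈ gen S X :=
  Submodule.subset_span ⟨s, hs, x, hx, rfl⟩

theorem subset_gen (S : Subgroup G) (X : Set (G →₀ C)) : X ⊆ gen S X := fun x hx => by
  simpa using act_mem_gen S.one_mem hx

theorem gen_le {S : Subgroup G} {X : Set (G →₀ C)} {N : Submodule C (G →₀ C)}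
    (hN : Stable S N) (hX : X ⊆ N) : gen S X ≤ N := by
  refine Submodule.span_le.2 ?_
  rintro _ ⟨s, hs, x, hx, rfl⟩
  exact hN s hs x (hX hx)

theorem gen_mono {S T : Subgroup G} (h : S ≤ T) {X Y : Set (G →₀ C)} (hXY : X ⊆ Y) :
    gen S X ≤ gen T Y :=
  Submodule.span_mono (Set.image2_subset h hXY)

/-- A semilinear map carries a span into a submodule as soon as it does so for the generators. -/
theorem act_mem_of_span {g : G} {X : Set (G →₀ C)} {N : Submodule C (G →₀ C)}
    (h : ∀ x ∈ X, act g x ∈ N) {x : G →₀ C} (hx : x ∈ Submodule.span C X) : act g x ∈ N := by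
  induction hx using Submodule.span_induction with
  | mem x hx => exact h x hx
  | zero => simp
  | add x y _ _ hx hy => rw [map_add]; exact N.add_mem hx hy
  | smul c x _ hx => rw [act_smul]; exact N.smul_mem _ hx

theorem stable_gen (S : Subgroup G) (X : Set (G →₀ C)) : Stable S (gen S X) := by
  intro s hs x hx
  refine act_mem_of_span ?_ hx
  rintro _ ⟨r, hr, x, hx, rfl⟩
  rw [act_act]
  exact act_mem_gen (S.mul_mem hs hr) hx

theorem act_mem_coeffIn {b : Ideal C} {f : G →₀ C} (g : G) (hf : f ∈ coeffIn b) :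
    act g f ∈ coeffIn (g • b) := fun x => by
  rw [act_apply]
  exact Ideal.smul_mem_pointwise_smul _ _ _ (hf _)

theorem act_mem_smul {a : Ideal C} {N N' : Submodule C (G →₀ C)} {g : G}
    (h : ∀ x ∈ N, act g x ∈ N') {x : G →₀ C} (hx : x ∈ a • N) : act g x ∈ (g • a) • N' := by
  induction hx using Submodule.smul_induction_on' with
  | smul r hr n hn =>
    rw [act_smul]
    exact Submodule.smul_mem_smul (Ideal.smul_mem_pointwise_smul _ _ _ hr) (h n hn)
  | add x _ y _ hx hy => rw [map_add]; exact Submodule.add_mem _ hx hy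

theorem act_mem_supported {A A' : Set G} {g : G} (h : ∀ x ∈ A, g * x ∈ A') {f : G →₀ C}
    (hf : f ∈ Finsupp.supported C C A) : act g f ∈ Finsupp.supported C C A' := by
  rw [Finsupp.mem_supported'] at hf ⊢
  intro x hx
  rw [act_apply, hf, smul_zero]
  intro h'
  exact hx (by simpa using h _ h')

theorem stable_supported {S : Subgroup G} {A : Set G} (h : ∀ s ∈ S, ∀ x ∈ A, s * x ∈ A) :
    Stable S (Finsupp.supported C C A) :=
  fun s hs _ hf => act_mem_supported (h s hs) hf

theorem act_res {A : Set G} {g : G} {A' : Set G} (h : ∀ x, g * x ∈ A' ↔ x ∈ A) (f : G →₀ C) :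
    act g (res A f) = res A' (act g f) := by
  ext x
  have := h (g⁻¹ * x)
  rw [mul_inv_cancel_left] at this
  by_cases hx : x ∈ A'
  · simp [res_apply, hx, this.1 hx]
  · simp [res_apply, hx, mt this.2 hx]

end Twisted

/-! ### Sets covered by finitely many right cosets. -/

section Cosets

variable {G : Type*} [Group G]

/-- A subset stable under left multiplication by a subgroup, and covered by finitely many of its
right cosets. -/
def Cofin (S : Subgroup G) (Y : Set G) : Prop :=
  (∀ s ∈ S, ∀ y ∈ Y, s * y ∈ Y) ∧ ∃ F : Set G, F.Finite ∧ ∀ y ∈ Y, ∃ f ∈ F, ∃ s ∈ S, y = s * f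

theorem cofin_univ : Cofin (⊤ : Subgroup G) (Set.univ : Set G) :=
  ⟨fun _ _ _ _ => trivial, {1}, Set.finite_singleton 1, fun y _ => ⟨1, rfl, y, trivial, by simp⟩⟩

theorem Cofin.of_relIndex {S S' : Subgroup G} (h : S' ≤ S) (hfin : S'.relIndex S ≠ 0) {Y : Set G}
    (hY : Cofin S Y) : Cofin S' Y := by
  obtain ⟨hst, F, hF, hcov⟩ := hY
  refine ⟨fun s hs => hst s (h hs), ?_⟩
  have : (S'.subgroupOf S).FiniteIndex := ⟨hfin⟩
  let Q := S ⧸ S'.subgroupOf S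
  have : Finite Q := inferInstance
  -- Inverses of left coset representatives represent the right cosets of `S'` in `S`.
  refine ⟨Set.image2 (fun (q : Q) f => ((q.out : S) : G)⁻¹ * f) Set.univ F,
    Set.Finite.image2 _ Set.finite_univ hF, ?_⟩
  intro y hy
  obtain ⟨f, hf, s, hs, rfl⟩ := hcov y hy
  let q : Q := ((⟨s, hs⟩ : S)⁻¹ : S)
  refine ⟨((q.out : S) : G)⁻¹ * f, ⟨q, trivial, f, hf, rfl⟩, s * (q.out : S), ?_, by group⟩
  have h1 : ((q.out : S) : Q) = ((⟨s, hs⟩ : S)⁻¹ : S) := q.out_eq'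
  have h2 := QuotientGroup.eq.1 h1.symm
  rw [inv_inv, Subgroup.mem_subgroupOf] at h2
  exact h2

end Cosets

/-! ### Reduction by degree and leading coefficients. -/

section Degrees

variable {C G : Type*} [CommRing C]

/-- The top coefficients of elements of `N`, in degrees above `A`, can be removed by elements of
`E` supported in degrees at least `-A`. -/
def TopReducible (blk : G → ℤ) (N E : Submodule C (G →₀ C)) (A : ℤ) : Prop :=
  ∀ n, A < n → ∀ y ∈ N, y ∈ Finsupp.supported C C {y | blk y ≤ n} →
    ∃ e ∈ E, e ∈ Finsupp.supported C C {y | -A ≤ blk y} ∧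
      y - e ∈ Finsupp.supported C C {y | blk y ≤ n - 1}

theorem TopReducible.mono {blk : G → ℤ} {N E E' : Submodule C (G →₀ C)} {A A' : ℤ}
    (h : TopReducible blk N E A) (hE : E ≤ E') (hA : A ≤ A') : TopReducible blk N E' A' := by
  intro n hn y hy hyn
  obtain ⟨e, he, hes, hye⟩ := h n (hA.trans_lt hn) y hy hyn
  refine ⟨e, hE he, Finsupp.supported_mono ?_ hes, hye⟩
  intro z hz
  simp only [Set.mem_ofPred_eq] at hz ⊢
  omega

theorem exists_le_of_finsupp (blk : G → ℤ) (f : G →₀ C) :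
    ∃ n : ℕ, f ∈ Finsupp.supported C C {y | -(n : ℤ) ≤ blk y ∧ blk y ≤ n} := by
  refine ⟨f.support.sup fun y => (blk y).natAbs, fun y hy => ?_⟩
  have := Finset.le_sup (f := fun y => (blk y).natAbs) hy
  simp only [Set.mem_ofPred_eq] at this ⊢
  omega

/-- Clear the top degree repeatedly until `A` is reached. The corrections live in degrees at least
`-A ≥ -m`, so the lower end of the support never drops below `-m`. -/
theorem TopReducible.sweep {blk : G → ℤ} {N E : Submodule C (G →₀ C)} {A : ℤ}
    (h : TopReducible blk N E A) (hE : E ≤ N) {m : ℤ} (hm : A ≤ m) {y : G →₀ C} (hy : y ∈ N)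
    (hym : y ∈ Finsupp.supported C C {y | -m ≤ blk y}) :
    ∃ e ∈ E, y - e ∈ Finsupp.supported C C {y | -m ≤ blk y ∧ blk y ≤ A} := by
  have key : ∀ k : ℕ, ∀ y ∈ N, y ∈ Finsupp.supported C C {y | -m ≤ blk y} →
      y ∈ Finsupp.supported C C {y | blk y ≤ A + k} →
      ∃ e ∈ E, y - e ∈ Finsupp.supported C C {y | -m ≤ blk y ∧ blk y ≤ A} := by
    intro k
    induction k with
    | zero =>
      intro y _ h1 h2
      refine ⟨0, E.zero_mem, ?_⟩
      rw [sub_zero]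
      exact fun z hz => ⟨h1 hz, by simpa using h2 hz⟩
    | succ k ih =>
      intro y hy h1 h2
      obtain ⟨e, he, hes, hye⟩ := h (A + (k + 1 : ℕ)) (by push_cast; omega) y hy h2
      obtain ⟨e', he', h'⟩ := ih (y - e) (N.sub_mem hy (hE he))
        (Submodule.sub_mem _ h1 (Finsupp.supported_mono (fun z hz => by
          simp only [Set.mem_ofPred_eq] at hz ⊢; omega) hes))
        (Finsupp.supported_mono (fun z hz => by
          simp only [Set.mem_ofPred_eq] at hz ⊢; push_cast at hz; omega) hye)
      exact ⟨e + e', E.add_mem he he', by rwa [← sub_sub]⟩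
  obtain ⟨n, hn⟩ := exists_le_of_finsupp blk y
  refine key (n - A).toNat y hy hym (Finsupp.supported_mono (fun z hz => ?_) hn)
  simp only [Set.mem_ofPred_eq] at hz ⊢
  omega

/-- Sweep from above, then from below with the degree negated. The corrections of the second sweep
have degree at most `A`, so they do not undo the first. -/
theorem le_sup_window {blk : G → ℤ} {N E : Submodule C (G →₀ C)} {A : ℤ}
    (h : TopReducible blk N E A) (h' : TopReducible (fun y => -blk y) N E A) (hE : E ≤ N) :
    N ≤ E ⊔ (N ⊓ Finsupp.supported C C {y | -A ≤ blk y ∧ blk y ≤ A}) := by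
  intro y hy
  obtain ⟨n, hn⟩ := exists_le_of_finsupp blk y
  obtain ⟨e, he, h1⟩ := h.sweep hE (le_max_left A n) hy
    (Finsupp.supported_mono (fun z hz => by simp only [Set.mem_ofPred_eq] at hz ⊢; omega) hn)
  obtain ⟨e', he', h2⟩ := h'.sweep hE le_rfl (N.sub_mem hy (hE he))
    (Finsupp.supported_mono (fun z hz => by simp only [Set.mem_ofPred_eq] at hz ⊢; omega) h1)
  refine Submodule.mem_sup.2 ⟨e + e', E.add_mem he he', y - e - e', ⟨?_, ?_⟩, by abel⟩
  · exact N.sub_mem (N.sub_mem hy (hE he)) (hE he')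
  · exact Finsupp.supported_mono (fun z hz => by simp only [Set.mem_ofPred_eq] at hz ⊢; omega) h2

/-- The coefficients in degree zero of the elements of `N` supported in nonpositive degrees. -/
noncomputable def lead (blk : G → ℤ) (N : Submodule C (G →₀ C)) : Submodule C (G →₀ C) :=
  (N ⊓ Finsupp.supported C C {y | blk y ≤ 0}).map (res {y | blk y = 0})

/-- The part of `lead blk N` coming from elements supported in degrees at least `-A`. -/
noncomputable def boundedLead (blk : G → ℤ) (N : Submodule C (G →₀ C)) (A : ℤ) :
    Submodule C (G →₀ C) :=
  (N ⊓ Finsupp.supported C C {y | -A ≤ blk y ∧ blk y ≤ 0}).map (res {y | blk y = 0})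

theorem lead_mono (blk : G → ℤ) {N N' : Submodule C (G →₀ C)} (h : N ≤ N') :
    lead blk N ≤ lead blk N' :=
  Submodule.map_mono (inf_le_inf_right _ h)

theorem boundedLead_mono (blk : G → ℤ) (N : Submodule C (G →₀ C)) {A A' : ℤ} (h : A ≤ A') :
    boundedLead blk N A ≤ boundedLead blk N A' := by
  refine Submodule.map_mono (inf_le_inf_left _ (Finsupp.supported_mono fun z hz => ?_))
  simp only [Set.mem_ofPred_eq] at hz ⊢
  omega

theorem lead_le_supported {blk : G → ℤ} {N : Submodule C (G →₀ C)} {Y : Set G}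
    (hN : N ≤ Finsupp.supported C C Y) :
    lead blk N ≤ Finsupp.supported C C {y | y ∈ Y ∧ 0 ≤ blk y ∧ blk y ≤ 0} := by
  rintro _ ⟨x, hx, rfl⟩
  rw [Finsupp.mem_supported']
  intro z hz
  rw [res_apply]
  split_ifs with h
  · refine Finsupp.mem_supported' C x |>.1 (hN hx.1) z fun hY => hz ⟨hY, ?_⟩
    simp only [Set.mem_ofPred_eq] at h
    omega
  · rfl

theorem lead_le_coeffIn {blk : G → ℤ} {N : Submodule C (G →₀ C)} {b : Ideal C}
    (hN : N ≤ coeffIn b) : lead blk N ≤ coeffIn b := by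
  rintro _ ⟨x, hx, rfl⟩
  exact res_mem_coeffIn _ (hN hx.1)

theorem smul_lead_le {blk : G → ℤ} {N L : Submodule C (G →₀ C)} {a : Ideal C}
    (hN : a • L ≤ N) : a • lead blk L ≤ lead blk N := by
  rw [lead, ← Submodule.map_smul'']
  refine Submodule.map_mono (le_inf ((Submodule.smul_mono le_rfl inf_le_left).trans hN) ?_)
  exact Submodule.smul_le_right.trans inf_le_right

theorem subset_boundedLead {blk : G → ℤ} {N : Submodule C (G →₀ C)} {X : Set (G →₀ C)}
    (hX : X.Finite) (hXN : X ⊆ lead blk N) : ∃ A : ℕ, X ⊆ boundedLead blk N A := by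
  induction X, hX using Set.Finite.induction_on with
  | empty => exact ⟨0, Set.empty_subset _⟩
  | @insert x X _ _ ih =>
    obtain ⟨A, hA⟩ := ih ((Set.subset_insert _ _).trans hXN)
    obtain ⟨y, hy, hyx⟩ := hXN (Set.mem_insert _ _)
    obtain ⟨n, hn⟩ := exists_le_of_finsupp blk y
    refine ⟨max A n, Set.insert_subset ?_ ?_⟩
    · refine ⟨y, ⟨hy.1, fun z hz => ⟨?_, hy.2 hz⟩⟩, hyx⟩
      have := (hn hz).1
      push_cast
      omega
    · exact hA.trans (boundedLead_mono blk N (by push_cast; omega))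

theorem mem_supported_of_res_eq_zero {blk : G → ℤ} {z : G →₀ C}
    (hz : z ∈ Finsupp.supported C C {y | blk y ≤ 0}) (h : res {y | blk y = 0} z = 0) :
    z ∈ Finsupp.supported C C {y | blk y ≤ -1} := by
  rw [Finsupp.mem_supported'] at hz ⊢
  intro x hx
  by_cases h0 : blk x = 0
  · have := DFunLike.congr_fun h x
    rwa [res_apply, if_pos (show x ∈ {y | blk y = 0} from h0)] at this
  · apply hz
    simp only [Set.mem_ofPred_eq] at hx ⊢
    omega

theorem exists_finite_span [IsNoetherianRing C] {Y : Set G} (hY : Y.Finite)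
    {N : Submodule C (G →₀ C)} (hN : N ≤ Finsupp.supported C C Y) :
    ∃ X : Set (G →₀ C), X.Finite ∧ X ⊆ N ∧ N ≤ Submodule.span C X := by
  have := hY.to_subtype
  have : IsNoetherian C (Finsupp.supported C C Y) :=
    isNoetherian_of_linearEquiv (Finsupp.supportedEquivFinsupp Y).symm
  obtain ⟨X, hX, rfl⟩ := Submodule.fg_def.1 (isNoetherian_submodule.1 this N hN)
  exact ⟨X, hX, Submodule.subset_span, le_rfl⟩

theorem inf_window_le {Y : Set G} {L : Submodule C (G →₀ C)} (hL : L ≤ Finsupp.supported C C Y)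
    (blk : G → ℤ) (A : ℤ) : L ⊓ Finsupp.supported C C {y | -A ≤ blk y ∧ blk y ≤ A} ≤
      Finsupp.supported C C {y | y ∈ Y ∧ -A ≤ blk y ∧ blk y ≤ A} :=
  fun _ hf _ hz => ⟨hL hf.1 hz, hf.2 hz⟩

end Degrees

/-! ### Degree functions for infinite cyclic steps. -/

section Blocks

variable {C G : Type*} [CommRing C] [Group G]

/-- A block function: a function to the integers, invariant under a subgroup and
shifted by one by an element `t`. -/
structure IsBlock (S : Subgroup G) (t : G) (blk : G → ℤ) : Prop where
  invariant : ∀ s ∈ S, ∀ y, blk (s * y) = blk y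
  shift : ∀ y, blk (t * y) = blk y + 1

theorem IsBlock.shift_inv {S : Subgroup G} {t : G} {blk : G → ℤ} (h : IsBlock S t blk) (y : G) :
    blk (t⁻¹ * y) = blk y - 1 := by
  have := h.shift (t⁻¹ * y)
  rw [mul_inv_cancel_left] at this
  omega

theorem IsBlock.shift_zpow {S : Subgroup G} {t : G} {blk : G → ℤ} (h : IsBlock S t blk) (n : ℤ)
    (y : G) : blk (t ^ n * y) = blk y + n := by
  induction n using Int.induction_on with
  | zero => simp
  | succ n ih => rw [add_comm, zpow_add, zpow_one, mul_assoc, h.shift, ih]; ring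
  | pred n ih => rw [sub_eq_neg_add, zpow_add, zpow_neg_one, mul_assoc, h.shift_inv, ih]; ring

theorem IsBlock.neg {S : Subgroup G} {t : G} {blk : G → ℤ} (h : IsBlock S t blk) :
    IsBlock S t⁻¹ (fun y => -blk y) where
  invariant s hs y := by rw [h.invariant s hs]
  shift y := by rw [h.shift_inv]; ring

/-- One step of a polycyclic series: the smaller subgroup has finite index, or is the kernel of a
homomorphism to the integers. -/
def Step (S' S : Subgroup G) : Prop :=
  S' ≤ S ∧ (S'.relIndex S ≠ 0 ∨ ∃ δ : G → ℤ, (∀ x ∈ S, ∀ y ∈ S, δ (x * y) = δ x + δ y) ∧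
    ∀ x ∈ S, δ x = 0 ↔ x ∈ S')

/-- On each right coset of `S`, measure `δ` from a chosen representative. Floor division by `δ t`
makes `t` shift by exactly one even when `δ t` does not generate the image of `δ`. A bounded window
involves finitely many values of `δ`, hence finitely many cosets of `S'` over each representative.
-/
theorem exists_isBlock {S S' : Subgroup G} (hle : S' ≤ S) {δ : G → ℤ}
    (hadd : ∀ x ∈ S, ∀ y ∈ S, δ (x * y) = δ x + δ y) (hker : ∀ x ∈ S, δ x = 0 ↔ x ∈ S')
    {t : G} (ht : t ∈ S) (hd : 0 < δ t) :
    ∃ blk : G → ℤ, IsBlock S' t blk ∧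
      ∀ Y, Cofin S Y → ∀ a b, Cofin S' {y | y ∈ Y ∧ a ≤ blk y ∧ blk y ≤ b} := by
  let rep : G → G := fun y => (Quotient.mk (QuotientGroup.rightRel S) y).out
  have hrep : ∀ y, y * (rep y)⁻¹ ∈ S := fun y =>
    QuotientGroup.rightRel_apply.1 (Quotient.mk_out (s := QuotientGroup.rightRel S) y)
  have hrep' : ∀ s ∈ S, ∀ y, rep (s * y) = rep y := by
    intro s hs y
    have : Quotient.mk (QuotientGroup.rightRel S) (s * y) = Quotient.mk _ y := by
      refine Quotient.sound (QuotientGroup.rightRel_apply.2 ?_)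
      simpa using hs
    simp only [rep, this]
  let deg : G → ℤ := fun y => δ (y * (rep y)⁻¹)
  have hdeg : ∀ s ∈ S, ∀ y, deg (s * y) = δ s + deg y := by
    intro s hs y
    simp only [deg, hrep' s hs, mul_assoc]
    exact hadd s hs _ (hrep y)
  have hinv : ∀ s ∈ S', ∀ y, deg (s * y) / δ t = deg y / δ t := by
    intro s hs y
    rw [hdeg s (hle hs), (hker s (hle hs)).2 hs, zero_add]
  refine ⟨fun y => deg y / δ t, ⟨hinv, ?_⟩, ?_⟩
  · intro y
    simp only [hdeg t ht]
    rw [Int.add_ediv_of_dvd_left (dvd_refl _), Int.ediv_self hd.ne', add_comm]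
  rintro Y ⟨hst, F, hF, hcov⟩ a b
  refine ⟨fun s hs y hy => ⟨hst s (hle hs) y hy.1, by simpa only [hinv s hs] using hy.2⟩, ?_⟩
  -- Choose an element of `S` with `δ`-value `v`; for values not attained, `1` is a dummy.
  have hsv : ∀ v : ℤ, ∃ r ∈ S, (∃ s ∈ S, δ s = v) → δ r = v := by
    intro v
    by_cases h : ∃ s ∈ S, δ s = v
    · obtain ⟨s, hs, h⟩ := h
      exact ⟨s, hs, fun _ => h⟩
    · exact ⟨1, S.one_mem, fun h' => absurd h' h⟩
  choose sv hsvS hsv using hsv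
  refine ⟨Set.image2 (fun v f => sv v * rep f) (Set.Icc (a * δ t) (b * δ t + δ t)) F,
    Set.Finite.image2 _ (Set.finite_Icc _ _) hF, ?_⟩
  rintro y ⟨hy, hay, hby⟩
  obtain ⟨f, hf, s, hs, rfl⟩ := hcov y hy
  have hmem := hrep (s * f)
  rw [hrep' s hs] at hmem
  have hv : δ (s * f * (rep f)⁻¹) = deg (s * f) := by simp only [deg, hrep' s hs]
  refine ⟨_, ⟨deg (s * f), ⟨?_, ?_⟩, f, hf, rfl⟩,
    s * f * (rep f)⁻¹ * (sv (deg (s * f)))⁻¹, ?_, by group⟩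
  · exact (Int.le_ediv_iff_mul_le hd).1 hay
  · have := Int.lt_ediv_add_one_mul_self (deg (s * f)) hd
    nlinarith
  · have h1 : s * f * (rep f)⁻¹ * (sv (deg (s * f)))⁻¹ ∈ S := S.mul_mem hmem (S.inv_mem (hsvS _))
    refine (hker _ h1).1 ?_
    have h2 := hadd _ h1 _ (hsvS (deg (s * f)))
    rw [inv_mul_cancel_right, hv, hsv _ ⟨_, hmem, hv⟩] at h2
    omega

variable [MulSemiringAction G C]

theorem IsBlock.stable_window {S : Subgroup G} {t : G} {blk : G → ℤ} (h : IsBlock S t blk)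
    (p : ℤ → Prop) : Stable S (Finsupp.supported C C {y | p (blk y)}) :=
  stable_supported fun s hs y hy => by
    simpa only [Set.mem_ofPred_eq, h.invariant s hs] using hy

theorem IsBlock.stable_map_res {S : Subgroup G} {t : G} {blk : G → ℤ} (h : IsBlock S t blk)
    {N : Submodule C (G →₀ C)} (hN : Stable S N) :
    Stable S (N.map (res {y | blk y = 0})) := by
  rintro s hs _ ⟨x, hx, rfl⟩
  rw [act_res (A' := {y | blk y = 0}) fun y => by simp only [Set.mem_ofPred_eq, h.invariant s hs]]
  exact ⟨_, hN s hs x hx, rfl⟩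

theorem IsBlock.stable_lead {S : Subgroup G} {t : G} {blk : G → ℤ} (h : IsBlock S t blk)
    {N : Submodule C (G →₀ C)} (hN : Stable S N) : Stable S (lead blk N) :=
  h.stable_map_res (hN.inf (h.stable_window (· ≤ 0)))

theorem IsBlock.stable_boundedLead {S : Subgroup G} {t : G} {blk : G → ℤ} (h : IsBlock S t blk)
    {N : Submodule C (G →₀ C)} (hN : Stable S N) (A : ℤ) : Stable S (boundedLead blk N A) :=
  h.stable_map_res (hN.inf (h.stable_window fun n => -A ≤ n ∧ n ≤ 0))

theorem IsBlock.act_zpow_mem {S : Subgroup G} {t : G} {blk : G → ℤ} (h : IsBlock S t blk)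
    {p q : ℤ → Prop} {n : ℤ} (hpq : ∀ i, p i → q (i + n)) {x : G →₀ C}
    (hx : x ∈ Finsupp.supported C C {y | p (blk y)}) :
    act (t ^ n) x ∈ Finsupp.supported C C {y | q (blk y)} :=
  act_mem_supported (fun y hy => by
    simp only [Set.mem_ofPred_eq, h.shift_zpow] at hy ⊢
    exact hpq _ hy) hx

/-- An element with the same coefficients in degree `0` as a translate of `y` removes the top
coefficients of `y`. -/
theorem IsBlock.sub_act_mem {S : Subgroup G} {t : G} {blk : G → ℤ} (h : IsBlock S t blk)
    {n : ℤ} {y e : G →₀ C} (hy : y ∈ Finsupp.supported C C {y | blk y ≤ n})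
    (he : e ∈ Finsupp.supported C C {y | blk y ≤ 0})
    (hres : res {y | blk y = 0} e = res {y | blk y = 0} (act (t ^ (-n)) y)) :
    y - act (t ^ n) e ∈ Finsupp.supported C C {y | blk y ≤ n - 1} := by
  have h1 : act (t ^ (-n)) y - e ∈ Finsupp.supported C C {y | blk y ≤ 0} :=
    Submodule.sub_mem _
      (h.act_zpow_mem (p := (· ≤ n)) (q := (· ≤ 0)) (fun i hi => by omega) hy) he
  have h2 := mem_supported_of_res_eq_zero h1 (by rw [map_sub, hres, sub_self])
  have h3 := h.act_zpow_mem (p := (· ≤ -1)) (q := (· ≤ n - 1)) (n := n)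
    (fun i hi => by omega) h2
  rwa [map_sub, act_act, ← zpow_add, add_neg_cancel, zpow_zero, act_one] at h3

/-- If the ideal-theoretic condition holds for the leading coefficients, the top coefficients of
elements of `L ∩ b P` can be removed by elements of `b L`. -/
theorem IsBlock.exists_reduction {S : Subgroup G} {t : G} {blk : G → ℤ} (h : IsBlock S t blk)
    {L : Submodule C (G →₀ C)} (hL : ∀ n : ℤ, ∀ x ∈ L, act (t ^ n) x ∈ L) {A : ℤ}
    (hA : lead blk L ≤ boundedLead blk L A) {b : Ideal C} {n : ℤ}
    (hb : lead blk L ⊓ coeffIn (t ^ (-n) • b) ≤ (t ^ (-n) • b) • lead blk L)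
    {y : G →₀ C} (hy : y ∈ L ⊓ coeffIn b) (hyn : y ∈ Finsupp.supported C C {y | blk y ≤ n}) :
    ∃ e ∈ b • L, e ∈ Finsupp.supported C C {y | n - A ≤ blk y} ∧
      y - e ∈ Finsupp.supported C C {y | blk y ≤ n - 1} := by
  have h1 : res {y | blk y = 0} (act (t ^ (-n)) y) ∈ lead blk L ⊓ coeffIn (t ^ (-n) • b) := by
    refine ⟨⟨_, ⟨hL _ _ hy.1, ?_⟩, rfl⟩, res_mem_coeffIn _ (act_mem_coeffIn _ hy.2)⟩
    exact h.act_zpow_mem (p := (· ≤ n)) (q := (· ≤ 0)) (fun i hi => by omega) hyn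
  -- The leading part of the translated `y` now lifts to a bounded element of `(t ^ (-n) • b) • L`;
  -- translating back by `t ^ n` restores the ideal `b`.
  have h2 := Submodule.smul_mono le_rfl hA (hb h1)
  rw [boundedLead, ← Submodule.map_smul''] at h2
  obtain ⟨e, he, hres⟩ := h2
  have hew : e ∈ Finsupp.supported C C {y | -A ≤ blk y ∧ blk y ≤ 0} :=
    (Submodule.smul_le_right.trans inf_le_right) he
  refine ⟨act (t ^ n) e, ?_, ?_, h.sub_act_mem hyn (fun z hz => (hew hz).2) hres⟩
  · have := act_mem_smul (g := t ^ n) (fun x hx => hL n x hx)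
      (Submodule.smul_mono le_rfl inf_le_left he)
    rwa [smul_smul, ← zpow_add, add_neg_cancel, zpow_zero, one_smul] at this
  · exact h.act_zpow_mem (p := fun i => -A ≤ i ∧ i ≤ 0) (q := (n - A ≤ ·))
      (fun i hi => by omega) hew

end Blocks

/-! ### Induction along the subgroup series. -/

section Noetherian

variable {C G : Type*} [CommRing C] [Group G] [MulSemiringAction G C]

variable (C) in
/-- Stable submodules with support covered by finitely many cosets are finitely generated. -/
def Hilbert (S : Subgroup G) : Prop :=
  ∀ Y : Set G, Cofin S Y → ∀ N : Submodule C (G →₀ C), N ≤ Finsupp.supported C C Y →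
    Stable S N → ∃ X : Set (G →₀ C), X.Finite ∧ X ⊆ N ∧ N ≤ gen S X

/-- For `S`-stable `L`, the module `(L ∩ b P) / a L` is noetherian over `K ∩ S`. -/
def RelNoeth (S K : Subgroup G) (a b : Ideal C) : Prop :=
  ∀ Y : Set G, Cofin S Y → ∀ L : Submodule C (G →₀ C), L ≤ Finsupp.supported C C Y →
    Stable S L → ∀ N : Submodule C (G →₀ C), a • L ≤ N → N ≤ L ⊓ coeffIn b →
      Stable (K ⊓ S) N → ∃ X : Set (G →₀ C), X.Finite ∧ X ⊆ N ∧ N ≤ gen (K ⊓ S) X ⊔ a • L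

variable (C) in
/-- For `S`-stable `L`, the equality `L ∩ b P = b L` follows from finitely many conditions of the
same form on the translates of ideals. -/
def Vanish (S : Subgroup G) : Prop :=
  ∀ Y : Set G, Cofin S Y → ∀ L : Submodule C (G →₀ C), L ≤ Finsupp.supported C C Y →
    Stable S L → ∃ 𝒥 : Set (Ideal C), 𝒥.Finite ∧ ∀ b : Ideal C,
      (∀ s ∈ S, ∀ J ∈ 𝒥, b ⊓ s • J ≤ b * s • J) → L ⊓ coeffIn b ≤ b • L

theorem Cofin.finite {Y : Set G} (h : Cofin ⊥ Y) : Y.Finite := by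
  obtain ⟨-, F, hF, hY⟩ := h
  refine hF.subset fun y hy => ?_
  obtain ⟨f, hf, s, hs, rfl⟩ := hY y hy
  rw [Subgroup.mem_bot.1 hs, one_mul]
  exact hf

theorem span_le_gen (S : Subgroup G) (X : Set (G →₀ C)) : Submodule.span C X ≤ gen S X :=
  Submodule.span_le.2 (subset_gen S X)

theorem hilbert_bot [IsNoetherianRing C] : Hilbert C (⊥ : Subgroup G) := by
  intro Y hY N hN _
  obtain ⟨X, hX, hXN, h⟩ := exists_finite_span hY.finite hN
  exact ⟨X, hX, hXN, h.trans (span_le_gen _ X)⟩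

theorem relNoeth_bot [IsNoetherianRing C] (K : Subgroup G) (a b : Ideal C) :
    RelNoeth ⊥ K a b := by
  intro Y hY L hL _ N _ hN _
  obtain ⟨X, hX, hXN, h⟩ := exists_finite_span hY.finite ((hN.trans inf_le_left).trans hL)
  exact ⟨X, hX, hXN, (h.trans (span_le_gen _ X)).trans le_sup_left⟩

/-- Peel off one coordinate `y` at a time. The condition for the ideal of `y`-coefficients of `L`
matches `f y` by an element of `b • L`, and the difference is supported on one point fewer. -/
theorem vanish_bot : Vanish C (⊥ : Subgroup G) := by
  intro Y hY L hL hst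
  clear hst
  suffices ∃ 𝒥 : Set (Ideal C), 𝒥.Finite ∧ ∀ b : Ideal C,
      (∀ J ∈ 𝒥, b ⊓ J ≤ b * J) → L ⊓ coeffIn b ≤ b • L by
    obtain ⟨𝒥, h𝒥, h⟩ := this
    exact ⟨𝒥, h𝒥, fun b hb => h b fun J hJ => by simpa using hb 1 (Subgroup.one_mem _) J hJ⟩
  have hfin := hY.finite
  clear hY
  induction Y, hfin using Set.Finite.induction_on generalizing L with
  | empty =>
    refine ⟨∅, Set.finite_empty, fun b _ => ?_⟩
    rw [Finsupp.supported_empty, le_bot_iff] at hL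
    simp [hL]
  | @insert y Y _ _ ih =>
    obtain ⟨𝒥, h𝒥, h⟩ := ih (L ⊓ Finsupp.supported C C Y) inf_le_right
    refine ⟨insert (L.map (Finsupp.lapply y)) 𝒥, h𝒥.insert _, fun b hb f hf => ?_⟩
    have h1 : f y ∈ b * L.map (Finsupp.lapply y) :=
      hb _ (Set.mem_insert _ _) ⟨hf.2 y, f, hf.1, rfl⟩
    rw [← smul_eq_mul, ← Submodule.map_smul''] at h1
    obtain ⟨e, he, hey⟩ := h1
    have h2 : f - e ∈ b • (L ⊓ Finsupp.supported C C Y) := by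
      refine h b (fun J hJ => hb J (Set.mem_insert_of_mem _ hJ)) ⟨⟨?_, ?_⟩, ?_⟩
      · exact L.sub_mem hf.1 (Submodule.smul_le_right he)
      · refine (Finsupp.mem_supported' C _).2 fun z hz => ?_
        by_cases hzy : z = y
        · subst hzy
          have : e z = f z := hey
          simp [this]
        · exact (Finsupp.mem_supported' C _).1
            (L.sub_mem hf.1 (Submodule.smul_le_right he) |> fun h => hL h) z (by simp [hzy, hz])
      · exact Submodule.sub_mem _ hf.2 (smul_le_coeffIn _ _ he)
    rw [← sub_add_cancel f e]
    exact Submodule.add_mem _ (Submodule.smul_mono le_rfl inf_le_left h2) he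

theorem inf_le_mul_smul_iff {b J : Ideal C} (g : G) :
    g⁻¹ • b ⊓ J ≤ g⁻¹ • b * J ↔ b ⊓ g • J ≤ b * g • J := by
  constructor
  · intro h x hx
    have h1 : g⁻¹ • x ∈ g⁻¹ • b * J :=
      h ⟨Ideal.smul_mem_pointwise_smul _ _ _ hx.1,
        Ideal.mem_pointwise_smul_iff_inv_smul_mem.1 hx.2⟩
    have h2 := Ideal.smul_mem_pointwise_smul g _ _ h1
    rwa [smul_mul', smul_inv_smul, smul_inv_smul] at h2
  · intro h x hx
    have h1 : g • x ∈ b * g • J :=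
      h ⟨Ideal.mem_inv_pointwise_smul_iff.1 hx.1, Ideal.smul_mem_pointwise_smul _ _ _ hx.2⟩
    have h2 := Ideal.smul_mem_pointwise_smul g⁻¹ _ _ h1
    rwa [smul_mul', inv_smul_smul, inv_smul_smul] at h2

section BlockStep

variable {S' : Subgroup G} {t : G} {blk : G → ℤ}

/-- Leading coefficients with bounded lifts form an `S'`-stable submodule, so it is enough to lift
the finitely many generators given by `Hilbert`. -/
theorem IsBlock.exists_lead_le (h : IsBlock S' t blk) (hH : Hilbert C S') {Y : Set G}
    (hY : Cofin S' {y | y ∈ Y ∧ 0 ≤ blk y ∧ blk y ≤ 0}) {L : Submodule C (G →₀ C)}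
    (hL : L ≤ Finsupp.supported C C Y) (hst : Stable S' L) :
    ∃ A : ℕ, lead blk L ≤ boundedLead blk L A := by
  obtain ⟨X, hX, hXL, hgen⟩ := hH _ hY _ (lead_le_supported hL) (h.stable_lead hst)
  obtain ⟨A, hA⟩ := subset_boundedLead hX hXL
  exact ⟨A, hgen.trans (gen_le (h.stable_boundedLead hst A) hA)⟩

theorem IsBlock.topReducible_of_lead_le (h : IsBlock S' t blk) {N E : Submodule C (G →₀ C)}
    (hN : ∀ n : ℤ, ∀ x ∈ N, act (t ^ n) x ∈ N) (hE : ∀ n : ℤ, ∀ x ∈ E, act (t ^ n) x ∈ E) {A : ℕ}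
    (hA : lead blk N ≤ boundedLead blk E A) : TopReducible blk N E A := by
  intro n hn y hy hyn
  obtain ⟨e, he, hres⟩ := hA ⟨act (t ^ (-n)) y, ⟨hN _ _ hy,
    h.act_zpow_mem (p := (· ≤ n)) (q := (· ≤ 0)) (fun i hi => by omega) hyn⟩, rfl⟩
  refine ⟨act (t ^ n) e, hE _ _ he.1, ?_, h.sub_act_mem hyn (fun z hz => (he.2 hz).2) hres⟩
  exact h.act_zpow_mem (p := fun i => -A ≤ i ∧ i ≤ 0) (q := (-A ≤ ·))
    (fun i hi => by omega) he.2

theorem IsBlock.topReducible_of_inf_le (h : IsBlock S' t blk) {L : Submodule C (G →₀ C)}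
    (hL : ∀ n : ℤ, ∀ x ∈ L, act (t ^ n) x ∈ L) {A : ℕ} (hA : lead blk L ≤ boundedLead blk L A)
    {b : Ideal C} (hb : ∀ n : ℤ, A < n →
      lead blk L ⊓ coeffIn (t ^ (-n) • b) ≤ (t ^ (-n) • b) • lead blk L) :
    TopReducible blk (L ⊓ coeffIn b) (b • L) A := by
  intro n hn y hy hyn
  obtain ⟨e, he, hes, hye⟩ := h.exists_reduction hL hA (hb n hn) hy hyn
  refine ⟨e, he, Finsupp.supported_mono (fun z hz => ?_) hes, hye⟩
  simp only [Set.mem_ofPred_eq] at hz ⊢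
  omega

theorem IsBlock.exists_topReducible_of_vanish (h : IsBlock S' t blk) (hH : Hilbert C S')
    (hV : Vanish C S') {Y : Set G} (hY : Cofin S' {y | y ∈ Y ∧ 0 ≤ blk y ∧ blk y ≤ 0})
    {L : Submodule C (G →₀ C)} (hL : L ≤ Finsupp.supported C C Y) (hst : Stable S' L)
    (htL : ∀ n : ℤ, ∀ x ∈ L, act (t ^ n) x ∈ L) :
    ∃ 𝒥 : Set (Ideal C), 𝒥.Finite ∧ ∃ A₀ : ℕ, ∀ A : ℕ, A₀ ≤ A → ∀ b : Ideal C,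
      (∀ n : ℤ, A < n → ∀ s ∈ S', ∀ J ∈ 𝒥,
        b ⊓ (t ^ n * s) • J ≤ b * (t ^ n * s) • J) →
      TopReducible blk (L ⊓ coeffIn b) (b • L) A := by
  obtain ⟨A₀, hA₀⟩ := h.exists_lead_le hH hY hL hst
  obtain ⟨𝒥, h𝒥, hvan⟩ := hV _ hY _ (lead_le_supported hL) (h.stable_lead hst)
  refine ⟨𝒥, h𝒥, A₀, fun A hA b hb => ?_⟩
  refine h.topReducible_of_inf_le htL (hA₀.trans (boundedLead_mono _ _ (by exact_mod_cast hA)))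
    fun n hn => hvan _ fun s hs J hJ => ?_
  rw [zpow_neg, inf_le_mul_smul_iff, smul_smul]
  exact hb n hn s hs J hJ

/-- The reduction can fail only in degrees `n` for which some `t ^ n * s` lies in one of finitely
many cosets of `K`. There are finitely many such `n`, and `A` is taken beyond them. -/
theorem IsBlock.exists_topReducible_of_star (h : IsBlock S' t blk) (hH : Hilbert C S')
    (hV : Vanish C S') {Y : Set G} (hY : Cofin S' {y | y ∈ Y ∧ 0 ≤ blk y ∧ blk y ≤ 0})
    {L : Submodule C (G →₀ C)} (hL : L ≤ Finsupp.supported C C Y) {S : Subgroup G} (hle : S' ≤ S)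
    (ht : t ∈ S) (hst : Stable S L) {K : Subgroup G} (hK : K ⊓ S ≤ S') {I : Ideal C}
    (hstar : ∀ J : Ideal C, ∃ F : Set G, F.Finite ∧ ∀ g : G, ¬ I ⊓ g • J ≤ I * g • J →
      ∃ f ∈ F, ∃ k ∈ K, g = k * f) :
    ∃ A₀ : ℕ, ∀ A : ℕ, A₀ ≤ A → TopReducible blk (L ⊓ coeffIn I) (I • L) A := by
  obtain ⟨𝒥, h𝒥, A₀, hA₀⟩ := h.exists_topReducible_of_vanish hH hV hY hL (hst.mono hle)
    fun n x hx => hst _ (S.zpow_mem ht n) x hx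
  choose F hF hFg using hstar
  let bad : Set ℤ := {n | ∃ f ∈ ⋃ J ∈ 𝒥, F J, ∃ k ∈ K, ∃ s ∈ S', t ^ n * s = k * f}
  have hbad : bad.Finite := by
    have : ∀ n : ℤ, ∃ f, n ∈ bad → f ∈ ⋃ J ∈ 𝒥, F J ∧ ∃ k ∈ K, ∃ s ∈ S', t ^ n * s = k * f := by
      intro n
      by_cases hn : n ∈ bad
      · obtain ⟨f, hf⟩ := hn
        exact ⟨f, fun _ => hf⟩
      · exact ⟨1, fun h' => absurd h' hn⟩
    choose φ hφ using this
    refine Set.Finite.of_finite_image ((h𝒥.biUnion fun J _ => hF J).subset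
      (Set.image_subset_iff.2 fun n hn => (hφ n hn).1)) (f := φ) ?_
    intro n hn m hm hnm
    obtain ⟨-, k, hk, s, hs, hks⟩ := hφ n hn
    obtain ⟨-, k', hk', s', hs', hks'⟩ := hφ m hm
    rw [← hnm] at hks'
    -- Two degrees in the same coset give an element of K ∩ S ≤ S'. Elements of `S'` preserve
    -- degree, while this one shifts it by `n - m`.
    have h1 : t ^ n * (s * s'⁻¹ * t ^ (-m)) = k * k'⁻¹ := by
      have e1 : s = (t ^ n)⁻¹ * (k * φ n) := by rw [← hks]; group
      have e2 : s' = (t ^ m)⁻¹ * (k' * φ n) := by rw [← hks']; group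
      rw [e1, e2]; group
    have h2 : t ^ n * (s * s'⁻¹ * t ^ (-m)) ∈ S' := by
      refine hK ⟨h1 ▸ K.mul_mem hk (K.inv_mem hk'), ?_⟩
      exact S.mul_mem (S.zpow_mem ht n) (S.mul_mem (S.mul_mem (hle hs) (S.inv_mem (hle hs')))
        (S.zpow_mem ht _))
    have h3 := h.invariant _ h2 1
    rw [mul_assoc, h.shift_zpow, mul_assoc, h.invariant _ (S'.mul_mem hs (S'.inv_mem hs')),
      h.shift_zpow] at h3
    omega
  obtain ⟨A₁, hA₁⟩ := hbad.bddAbove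
  refine ⟨max A₀ A₁.toNat, fun A hA => hA₀ A (by omega) I fun n hn s hs J hJ => ?_⟩
  by_contra hcon
  obtain ⟨f, hf, k, hk, hkf⟩ := hFg J _ hcon
  have := hA₁ (a := n) ⟨f, Set.mem_biUnion hJ hf, k, hk, s, hs, hkf⟩
  omega

/-- Since `t` lies in `K`, both `N` and `a • L` are invariant under `t`. The hypothesis for `S'`
makes the leading module of `N` finitely generated modulo that of `a • L`; lifting the generators,
and using bounded lifts for `L`, gives one bound for all of it. -/
theorem IsBlock.exists_topReducible_of_mem (h : IsBlock S' t blk) (hH : Hilbert C S')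
    {K : Subgroup G} {a b : Ideal C} (hR : RelNoeth S' K a b) {Y : Set G}
    (hY : Cofin S' {y | y ∈ Y ∧ 0 ≤ blk y ∧ blk y ≤ 0})
    {L : Submodule C (G →₀ C)} (hL : L ≤ Finsupp.supported C C Y) {S : Subgroup G} (hle : S' ≤ S)
    (ht : t ∈ K ⊓ S) (hst : Stable S L) (haL : Stable (K ⊓ S) (a • L))
    {N : Submodule C (G →₀ C)} (haN : a • L ≤ N) (hN : N ≤ L ⊓ coeffIn b)
    (hstN : Stable (K ⊓ S) N) :
    ∃ X : Set (G →₀ C), X.Finite ∧ X ⊆ N ∧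
      ∃ A₀ : ℕ, ∀ A : ℕ, A₀ ≤ A → TopReducible blk N (gen (K ⊓ S) X ⊔ a • L) A := by
  have hle' : K ⊓ S' ≤ K ⊓ S := inf_le_inf_left _ hle
  have hK : IsBlock (K ⊓ S') t blk := ⟨fun s hs => h.invariant s hs.2, h.shift⟩
  obtain ⟨A₀, hA₀⟩ := h.exists_lead_le hH hY hL (hst.mono hle)
  obtain ⟨X, hX, hXN, hgen⟩ := hR _ hY _ (lead_le_supported hL) (h.stable_lead (hst.mono hle))
    (lead blk N) (smul_lead_le haN)
    (le_inf (lead_mono _ (hN.trans inf_le_left)) (lead_le_coeffIn (hN.trans inf_le_right)))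
    (hK.stable_lead (hstN.mono hle'))
  obtain ⟨A₁, hA₁⟩ := subset_boundedLead hX hXN
  have : ∀ x : X, ∃ y ∈ N ⊓ Finsupp.supported C C {y | -(A₁ : ℤ) ≤ blk y ∧ blk y ≤ 0},
      res {y | blk y = 0} y = x := fun x => hA₁ x.2
  choose lift hlift hres using this
  have := hX.to_subtype
  have hE : Stable (K ⊓ S) (gen (K ⊓ S) (Set.range lift) ⊔ a • L) := (stable_gen _ _).sup haL
  refine ⟨Set.range lift, Set.finite_range lift, ?_, max A₀ A₁, fun A hA => ?_⟩
  · rintro _ ⟨x, rfl⟩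
    exact (hlift x).1
  refine h.topReducible_of_lead_le (fun n x hx => hstN _ ((K ⊓ S).zpow_mem ht n) x hx)
    (fun n x hx => hE _ ((K ⊓ S).zpow_mem ht n) x hx) (hgen.trans (sup_le ?_ ?_))
  · refine gen_le (hK.stable_boundedLead (hE.mono hle') A) fun x hx => ?_
    refine boundedLead_mono (A := A₁) _ _ (by exact_mod_cast (le_max_right _ _).trans hA)
      ⟨lift ⟨x, hx⟩, ⟨?_, (hlift ⟨x, hx⟩).2⟩, hres ⟨x, hx⟩⟩
    exact le_sup_left (a := gen (K ⊓ S) (Set.range lift)) (subset_gen _ _ ⟨_, rfl⟩)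
  · refine (Submodule.smul_mono le_rfl (hA₀.trans (boundedLead_mono (A' := A) _ _ (by
      exact_mod_cast (le_max_left _ _).trans hA)))).trans ?_
    rw [boundedLead, ← Submodule.map_smul'']
    refine Submodule.map_mono (le_inf ?_ (Submodule.smul_le_right.trans inf_le_right))
    exact (Submodule.smul_mono le_rfl inf_le_left).trans le_sup_right

end BlockStep

theorem Cofin.neg {S' : Subgroup G} {Y : Set G} {blk : G → ℤ}
    (h : Cofin S' {y | y ∈ Y ∧ 0 ≤ blk y ∧ blk y ≤ 0}) :
    Cofin S' {y | y ∈ Y ∧ 0 ≤ -blk y ∧ -blk y ≤ 0} := by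
  have : {y | y ∈ Y ∧ 0 ≤ -blk y ∧ -blk y ≤ 0} = {y | y ∈ Y ∧ 0 ≤ blk y ∧ blk y ≤ 0} := by
    ext y
    constructor <;> rintro ⟨h1, h2, h3⟩ <;> exact ⟨h1, by omega, by omega⟩
  rwa [this]

theorem stable_smul {S K : Subgroup G} {a : Ideal C} (ha : ∀ k ∈ K, k • a = a)
    {L : Submodule C (G →₀ C)} (hL : Stable S L) : Stable (K ⊓ S) (a • L) := by
  intro s hs x hx
  have := act_mem_smul (hL s hs.2) hx
  rwa [ha s hs.1] at this

/-- In a step with kernel of a homomorphism, either nothing changes or there is a block function,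
for any element outside the kernel up to inversion. -/
theorem exists_isBlock_of_not_mem {S S' : Subgroup G} (hle : S' ≤ S) {δ : G → ℤ}
    (hadd : ∀ x ∈ S, ∀ y ∈ S, δ (x * y) = δ x + δ y) (hker : ∀ x ∈ S, δ x = 0 ↔ x ∈ S')
    {T : Subgroup G} (hTS : T ≤ S) (hT : ¬ T ≤ S') :
    ∃ t ∈ T, ∃ blk : G → ℤ, IsBlock S' t blk ∧
      ∀ Y, Cofin S Y → ∀ a b, Cofin S' {y | y ∈ Y ∧ a ≤ blk y ∧ blk y ≤ b} := by
  obtain ⟨t, ht, htS'⟩ := SetLike.not_le_iff_exists.1 hT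
  have h0 : δ t ≠ 0 := fun h => htS' ((hker t (hTS ht)).1 h)
  have h1 : δ t⁻¹ = -δ t := by
    have := hadd t (hTS ht) t⁻¹ (S.inv_mem (hTS ht))
    rw [mul_inv_cancel, (hker 1 S.one_mem).2 S'.one_mem] at this
    omega
  rcases lt_or_gt_of_ne h0 with h | h
  · exact ⟨t⁻¹, T.inv_mem ht, exists_isBlock hle hadd hker (hTS (T.inv_mem ht)) (by omega)⟩
  · exact ⟨t, ht, exists_isBlock hle hadd hker (hTS ht) h⟩

/-- The generators are those needed to clear high degrees, those for low degrees, and those of the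
remaining window, to which the hypothesis for `S'` applies. -/
theorem RelNoeth.of_mem {S S' K : Subgroup G} {a b : Ideal C} (hR : RelNoeth S' K a b)
    (hle : S' ≤ S) {δ : G → ℤ} (hadd : ∀ x ∈ S, ∀ y ∈ S, δ (x * y) = δ x + δ y)
    (hker : ∀ x ∈ S, δ x = 0 ↔ x ∈ S') (hK : ¬ K ⊓ S ≤ S') (ha : ∀ k ∈ K, k • a = a)
    (hH : Hilbert C S') : RelNoeth S K a b := by
  intro Y hY L hL hst N haN hN hstN
  obtain ⟨t, ht, blk, h, hcof⟩ := exists_isBlock_of_not_mem hle hadd hker inf_le_right hK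
  have hle' : K ⊓ S' ≤ K ⊓ S := inf_le_inf_left _ hle
  obtain ⟨X₁, hX₁, hXN₁, A₁, h₁⟩ := h.exists_topReducible_of_mem hH hR (hcof Y hY 0 0) hL hle ht
    hst (stable_smul ha hst) haN hN hstN
  obtain ⟨X₂, hX₂, hXN₂, A₂, h₂⟩ := h.neg.exists_topReducible_of_mem hH hR (hcof Y hY 0 0).neg hL
    hle ((K ⊓ S).inv_mem ht) hst (stable_smul ha hst) haN hN hstN
  let A := max A₁ A₂
  have hw : Stable S' (Finsupp.supported C C {y | -(A : ℤ) ≤ blk y ∧ blk y ≤ A}) :=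
    h.stable_window fun n => -(A : ℤ) ≤ n ∧ n ≤ A
  obtain ⟨X₃, hX₃, hXN₃, h₃⟩ := hR _ (hcof Y hY (-A) A) _ (inf_window_le hL blk A)
    ((hst.mono hle).inf hw)
    (N ⊓ Finsupp.supported C C {y | -(A : ℤ) ≤ blk y ∧ blk y ≤ A})
    (le_inf ((Submodule.smul_mono le_rfl inf_le_left).trans haN)
      (Submodule.smul_le_right.trans inf_le_right))
    (le_inf (inf_le_inf_right _ (hN.trans inf_le_left))
      (inf_le_left.trans (hN.trans inf_le_right)))
    ((hstN.mono hle').inf (hw.mono inf_le_right))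
  have hX : X₁ ∪ X₂ ∪ X₃ ⊆ N :=
    Set.union_subset (Set.union_subset hXN₁ hXN₂) fun x hx => (hXN₃ hx).1
  have hX₁₂ : X₁ ∪ X₂ ⊆ X₁ ∪ X₂ ∪ X₃ := Set.subset_union_left
  refine ⟨X₁ ∪ X₂ ∪ X₃, (hX₁.union hX₂).union hX₃, hX, ?_⟩
  have hsw := le_sup_window
    ((h₁ A (le_max_left _ _)).mono (E' := gen (K ⊓ S) (X₁ ∪ X₂ ∪ X₃) ⊔ a • L)
      (sup_le_sup_right (gen_mono le_rfl (Set.subset_union_left.trans hX₁₂)) _) le_rfl)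
    ((h₂ A (le_max_right _ _)).mono
      (sup_le_sup_right (gen_mono le_rfl (Set.subset_union_right.trans hX₁₂)) _) le_rfl)
    (sup_le (gen_le hstN hX) haN)
  refine hsw.trans (sup_le le_rfl (h₃.trans (sup_le_sup ?_ ?_)))
  · exact gen_mono hle' Set.subset_union_right
  · exact Submodule.smul_mono le_rfl inf_le_left

/-- Outside a window, elements of `L ⊓ coeffIn I` reduce modulo `I • L` alone, so only the window
contributes generators. -/
theorem RelNoeth.of_star {S S' K : Subgroup G} {I : Ideal C} (hR : RelNoeth S' K I I)
    (hle : S' ≤ S) {δ : G → ℤ} (hadd : ∀ x ∈ S, ∀ y ∈ S, δ (x * y) = δ x + δ y)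
    (hker : ∀ x ∈ S, δ x = 0 ↔ x ∈ S') (hS : ¬ S ≤ S') (hK : K ⊓ S ≤ S')
    (hH : Hilbert C S') (hV : Vanish C S')
    (hstar : ∀ J : Ideal C, ∃ F : Set G, F.Finite ∧ ∀ g : G, ¬ I ⊓ g • J ≤ I * g • J →
      ∃ f ∈ F, ∃ k ∈ K, g = k * f) : RelNoeth S K I I := by
  intro Y hY L hL hst N haN hN hstN
  obtain ⟨t, ht, blk, h, hcof⟩ := exists_isBlock_of_not_mem hle hadd hker le_rfl hS
  obtain ⟨A₁, h₁⟩ := h.exists_topReducible_of_star hH hV (hcof Y hY 0 0) hL hle ht hst hK hstar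
  obtain ⟨A₂, h₂⟩ := h.neg.exists_topReducible_of_star hH hV (hcof Y hY 0 0).neg hL hle
    (S.inv_mem ht) hst hK hstar
  let A := max A₁ A₂
  have hw : Stable S' (Finsupp.supported C C {y | -(A : ℤ) ≤ blk y ∧ blk y ≤ A}) :=
    h.stable_window fun n => -(A : ℤ) ≤ n ∧ n ≤ A
  have hle' : K ⊓ S' ≤ K ⊓ S := inf_le_inf_left _ hle
  obtain ⟨X, hX, hXN, h₃⟩ := hR _ (hcof Y hY (-A) A) _ (inf_window_le hL blk A)
    ((hst.mono hle).inf hw)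
    (N ⊓ Finsupp.supported C C {y | -(A : ℤ) ≤ blk y ∧ blk y ≤ A})
    (le_inf ((Submodule.smul_mono le_rfl inf_le_left).trans haN)
      (Submodule.smul_le_right.trans inf_le_right))
    (le_inf (inf_le_inf_right _ (hN.trans inf_le_left))
      (inf_le_left.trans (hN.trans inf_le_right)))
    ((hstN.mono hle').inf (hw.mono inf_le_right))
  refine ⟨X, hX, fun x hx => (hXN hx).1, ?_⟩
  have hsw := le_sup_window (N := N) (fun n hn y hy => h₁ A (le_max_left _ _) n hn y (hN hy))
    (fun n hn y hy => h₂ A (le_max_right _ _) n hn y (hN hy)) haN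
  refine hsw.trans (sup_le le_sup_right (h₃.trans (sup_le_sup ?_ ?_)))
  · exact gen_mono hle' le_rfl
  · exact Submodule.smul_mono le_rfl inf_le_left

theorem RelNoeth.of_relIndex {S S' K : Subgroup G} {a b : Ideal C} (hR : RelNoeth S' K a b)
    (hle : S' ≤ S) (hfin : S'.relIndex S ≠ 0) : RelNoeth S K a b := by
  intro Y hY L hL hst N haN hN hstN
  have hle' : K ⊓ S' ≤ K ⊓ S := inf_le_inf_left _ hle
  obtain ⟨X, hX, hXN, h⟩ := hR Y (hY.of_relIndex hle hfin) L hL (hst.mono hle) N haN hN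
    (hstN.mono hle')
  exact ⟨X, hX, hXN, h.trans (sup_le_sup_right (gen_mono hle' le_rfl) _)⟩

/-- This lets the basis theorem for `S` be proved by the same inductive steps as the relative
statement. -/
theorem hilbert_iff_relNoeth {S : Subgroup G} :
    Hilbert C S ↔ RelNoeth S ⊤ (⊥ : Ideal C) ⊤ := by
  constructor
  · intro h Y hY L hL _ N _ hN hstN
    rw [top_inf_eq] at hstN ⊢
    obtain ⟨X, hX, hXN, h⟩ := h Y hY N ((hN.trans inf_le_left).trans hL) hstN
    exact ⟨X, hX, hXN, h.trans le_sup_left⟩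
  · intro h Y hY N hN hst
    obtain ⟨X, hX, hXN, h⟩ := h Y hY N hN hst N (by simp)
      (le_inf le_rfl fun f _ x => Submodule.mem_top) (by rwa [top_inf_eq])
    rw [top_inf_eq, Submodule.bot_smul, sup_bot_eq] at h
    exact ⟨X, hX, hXN, h⟩

theorem Hilbert.of_step {S S' : Subgroup G} (hH : Hilbert C S') (h : Step S' S) :
    Hilbert C S := by
  obtain ⟨hle, hfin | ⟨δ, hadd, hker⟩⟩ := h
  · exact hilbert_iff_relNoeth.2 ((hilbert_iff_relNoeth.1 hH).of_relIndex hle hfin)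
  · by_cases hS : S ≤ S'
    · rwa [le_antisymm hS hle]
    · exact hilbert_iff_relNoeth.2 ((hilbert_iff_relNoeth.1 hH).of_mem hle hadd hker
        (by rwa [top_inf_eq]) (fun k _ => Ideal.smul_bot k) hH)

/-- The assumption on `b` covers all translates by `S`, including those by powers of `t`, so every
degree outside the window reduces; the window needs only finitely many further ideals. -/
theorem Vanish.of_step {S S' : Subgroup G} (hV : Vanish C S') (hH : Hilbert C S')
    (h : Step S' S) : Vanish C S := by
  obtain ⟨hle, hfin | ⟨δ, hadd, hker⟩⟩ := h
  · intro Y hY L hL hst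
    obtain ⟨𝒥, h𝒥, h⟩ := hV Y (hY.of_relIndex hle hfin) L hL (hst.mono hle)
    exact ⟨𝒥, h𝒥, fun b hb => h b fun s hs => hb s (hle hs)⟩
  by_cases hS : S ≤ S'
  · rwa [le_antisymm hS hle]
  intro Y hY L hL hst
  obtain ⟨t, ht, blk, h, hcof⟩ := exists_isBlock_of_not_mem hle hadd hker le_rfl hS
  obtain ⟨𝒥₁, h𝒥₁, A₁, h₁⟩ := h.exists_topReducible_of_vanish hH hV (hcof Y hY 0 0) hL
    (hst.mono hle) fun n x hx => hst _ (S.zpow_mem ht n) x hx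
  obtain ⟨𝒥₂, h𝒥₂, A₂, h₂⟩ := h.neg.exists_topReducible_of_vanish hH hV (hcof Y hY 0 0).neg hL
    (hst.mono hle) fun n x hx => hst _ (S.zpow_mem (S.inv_mem ht) n) x hx
  let A := max A₁ A₂
  have hw : Stable S' (Finsupp.supported C C {y | -(A : ℤ) ≤ blk y ∧ blk y ≤ A}) :=
    h.stable_window fun n => -(A : ℤ) ≤ n ∧ n ≤ A
  obtain ⟨𝒥₃, h𝒥₃, h₃⟩ := hV _ (hcof Y hY (-A) A) _ (inf_window_le hL blk A)
    ((hst.mono hle).inf hw)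
  refine ⟨𝒥₁ ∪ 𝒥₂ ∪ 𝒥₃, (h𝒥₁.union h𝒥₂).union h𝒥₃, fun b hb => ?_⟩
  refine (le_sup_window (h₁ A (le_max_left _ _) b fun n _ s hs J hJ => ?_)
    (h₂ A (le_max_right _ _) b fun n _ s hs J hJ => ?_)
    (le_inf Submodule.smul_le_right (smul_le_coeffIn _ _))).trans (sup_le le_rfl ?_)
  · exact hb _ (S.mul_mem (S.zpow_mem ht n) (hle hs)) J (.inl (.inl hJ))
  · exact hb _ (S.mul_mem (S.zpow_mem (S.inv_mem ht) n) (hle hs)) J (.inl (.inr hJ))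
  · rw [inf_right_comm]
    exact (h₃ b fun s hs J hJ => hb s (hle hs) J (.inr hJ)).trans
      (Submodule.smul_mono le_rfl inf_le_left)

theorem RelNoeth.of_step {S S' K : Subgroup G} {I : Ideal C} (hR : RelNoeth S' K I I)
    (hV : Vanish C S') (hH : Hilbert C S') (hI : ∀ k ∈ K, k • I = I)
    (hstar : ∀ J : Ideal C, ∃ F : Set G, F.Finite ∧ ∀ g : G, ¬ I ⊓ g • J ≤ I * g • J →
      ∃ f ∈ F, ∃ k ∈ K, g = k * f) (h : Step S' S) : RelNoeth S K I I := by
  obtain ⟨hle, hfin | ⟨δ, hadd, hker⟩⟩ := h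
  · exact hR.of_relIndex hle hfin
  by_cases hS : S ≤ S'
  · rwa [le_antisymm hS hle]
  by_cases hK : K ⊓ S ≤ S'
  · exact hR.of_star hle hadd hker hS hK hH hV hstar
  · exact hR.of_mem hle hadd hker hK hI hH

theorem hilbert_of_reflTransGen [IsNoetherianRing C] {S : Subgroup G}
    (h : Relation.ReflTransGen Step ⊥ S) : Hilbert C S := by
  induction h with
  | refl => exact hilbert_bot
  | tail _ h ih => exact ih.of_step h

theorem vanish_of_reflTransGen [IsNoetherianRing C] {S : Subgroup G}
    (h : Relation.ReflTransGen Step ⊥ S) : Vanish C S := by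
  induction h with
  | refl => exact vanish_bot
  | tail h₀ h ih => exact ih.of_step (hilbert_of_reflTransGen h₀) h

theorem relNoeth_of_reflTransGen [IsNoetherianRing C] {S K : Subgroup G} {I : Ideal C}
    (hI : ∀ k ∈ K, k • I = I)
    (hstar : ∀ J : Ideal C, ∃ F : Set G, F.Finite ∧ ∀ g : G, ¬ I ⊓ g • J ≤ I * g • J →
      ∃ f ∈ F, ∃ k ∈ K, g = k * f)
    (h : Relation.ReflTransGen Step ⊥ S) : RelNoeth S K I I := by
  induction h with
  | refl => exact relNoeth_bot K I I
  | tail h₀ h ih =>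
    exact ih.of_step (vanish_of_reflTransGen h₀) (hilbert_of_reflTransGen h₀) hI hstar h

end Noetherian

/-! ### Tor as (I ∩ J)/IJ, and reduction to primes. -/

section Tor

open TensorProduct

variable {C : Type*} [CommRing C]

/-- Whether `ker p ∩ I P = I ker p` depends only on the target of the surjection `p` from a
projective module. -/
theorem ker_inf_smul_le_of_projective {P Q M : Type*} [AddCommGroup P] [Module C P]
    [AddCommGroup Q] [Module C Q] [AddCommGroup M] [Module C M] [Module.Projective C P]
    [Module.Projective C Q] {p : P →ₗ[C] M} {q : Q →ₗ[C] M} (hp : Function.Surjective p)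
    (hq : Function.Surjective q) {I : Ideal C}
    (h : LinearMap.ker p ⊓ I • ⊤ ≤ I • LinearMap.ker p) :
    LinearMap.ker q ⊓ I • ⊤ ≤ I • LinearMap.ker q := by
  obtain ⟨f, hf⟩ := Module.projective_lifting_property q p hq
  obtain ⟨g, hg⟩ := Module.projective_lifting_property p q hp
  have hf' : ∀ x, q (f x) = p x := LinearMap.congr_fun hf
  have hg' : ∀ x, p (g x) = q x := LinearMap.congr_fun hg
  rintro z ⟨hz, hzI⟩
  have h1 : g z ∈ I • LinearMap.ker p := by
    refine h ⟨by simpa [hg'] using hz, ?_⟩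
    have := Submodule.mem_map_of_mem (f := g) hzI
    rw [Submodule.map_smul''] at this
    exact Submodule.smul_mono le_rfl le_top this
  have h2 : f (g z) ∈ I • LinearMap.ker q := by
    have := Submodule.mem_map_of_mem (f := f) h1
    rw [Submodule.map_smul''] at this
    refine Submodule.smul_mono le_rfl ?_ this
    rintro _ ⟨x, hx, rfl⟩
    simpa [hf'] using hx
  -- `id - f ∘ g` has image in `ker q`, hence carries `I • ⊤` into `I • ker q`.
  have h3 : (LinearMap.id - f ∘ₗ g : Q →ₗ[C] Q) z ∈ I • LinearMap.ker q := by
    have := Submodule.mem_map_of_mem (f := (LinearMap.id - f ∘ₗ g : Q →ₗ[C] Q)) hzI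
    rw [Submodule.map_smul''] at this
    refine Submodule.smul_mono le_rfl ?_ this
    rintro _ ⟨x, -, rfl⟩
    simp [hf', hg']
  have h4 : z = (LinearMap.id - f ∘ₗ g : Q →ₗ[C] Q) z + f (g z) := by simp
  rw [h4]
  exact Submodule.add_mem _ h3 h2

theorem quot_tmul_eq_zero_iff {P : Type*} [AddCommGroup P] [Module C P] (I : Ideal C) (x : P) :
    (1 : C ⧸ I) ⊗ₜ[C] x = 0 ↔ x ∈ I • (⊤ : Submodule C P) := by
  rw [← (quotTensorEquivQuotSMul P I).map_eq_zero_iff, quotTensorEquivQuotSMul_mk_one_tmul,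
    Submodule.Quotient.mk_eq_zero]

theorem exists_quot_tmul {P : Type*} [AddCommGroup P] [Module C P] (I : Ideal C)
    (z : (C ⧸ I) ⊗[C] P) : ∃ x : P, z = (1 : C ⧸ I) ⊗ₜ[C] x := by
  obtain ⟨x, hx⟩ := Submodule.Quotient.mk_surjective _ (quotTensorEquivQuotSMul P I z)
  refine ⟨x, (quotTensorEquivQuotSMul P I).injective ?_⟩
  rw [quotTensorEquivQuotSMul_mk_one_tmul, hx]

/-- Every element of the tensor product with `C ⧸ I` is `1 ⊗ x`, and it vanishes exactly when `x ∈ I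
• ⊤`. Exactness thus says that `g x ∈ I • ⊤` forces `x` into the range of `f` plus `I • ⊤`. -/
theorem lTensor_exact_iff {P₂ P₁ P₀ : Type*} [AddCommGroup P₂] [Module C P₂] [AddCommGroup P₁]
    [Module C P₁] [AddCommGroup P₀] [Module C P₀] {f : P₂ →ₗ[C] P₁} {g : P₁ →ₗ[C] P₀}
    (hfg : ∀ x, g x = 0 → ∃ y, f y = x) (hgf : ∀ y, g (f y) = 0) (I : Ideal C) :
    (∀ z, g.lTensor (C ⧸ I) z = 0 → ∃ w, f.lTensor (C ⧸ I) w = z) ↔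
      LinearMap.range g ⊓ I • ⊤ ≤ I • LinearMap.range g := by
  rw [LinearMap.range_eq_map, ← Submodule.map_smul'']
  constructor
  · rintro h _ ⟨⟨x, -, rfl⟩, hx⟩
    obtain ⟨w, hw⟩ := h (1 ⊗ₜ x) (by
      rw [LinearMap.lTensor_tmul]
      exact (quot_tmul_eq_zero_iff _ _).2 hx)
    obtain ⟨y, rfl⟩ := exists_quot_tmul I w
    rw [LinearMap.lTensor_tmul] at hw
    refine ⟨x - f y, (quot_tmul_eq_zero_iff I _).1 ?_, ?_⟩
    · rw [tmul_sub, hw, sub_self]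
    · rw [map_sub, hgf, sub_zero]
  · intro h z hz
    obtain ⟨x, rfl⟩ := exists_quot_tmul I z
    rw [LinearMap.lTensor_tmul] at hz
    obtain ⟨i, hi, hix⟩ := h ⟨⟨x, trivial, rfl⟩, (quot_tmul_eq_zero_iff _ _).1 hz⟩
    obtain ⟨y, hy⟩ := hfg (x - i) (by rw [map_sub, hix, sub_self])
    refine ⟨1 ⊗ₜ y, ?_⟩
    rw [LinearMap.lTensor_tmul, hy, tmul_sub, (quot_tmul_eq_zero_iff I i).2 hi, sub_zero]

/-- A projective resolution gives the criterion for its augmentation onto `C ⧸ J`; comparison of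
projective covers in the sense of surjections replaces the augmentation by `C → C ⧸ J`, with kernel
`J`. -/
theorem isZero_torOne_iff (I J : Ideal C) : IsZero (torOne I J) ↔ I ⊓ J ≤ I * J := by
  let P := projectiveResolution (ModuleCat.of C (C ⧸ J))
  let F := (MonoidalCategory.tensoringLeft (ModuleCat C)).obj (ModuleCat.of C (C ⧸ I))
  have e : torOne I J ≅ ((F.mapHomologicalComplex _).obj P.complex).homology 1 :=
    P.isoLeftDerivedObj F 1
  have hproj : Module.Projective C (P.complex.X 0) :=
    (IsProjective.iff_projective _).2 (P.projective 0)
  rw [e.isZero_iff, ← HomologicalComplex.exactAt_iff_isZero_homology,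
    HomologicalComplex.exactAt_iff' _ 2 1 0 (by simp) (by simp),
    ShortComplex.moduleCat_exact_iff]
  have h21 := (ShortComplex.moduleCat_exact_iff _).1 (P.exact_succ 0)
  have h10 := (ShortComplex.moduleCat_exact_iff _).1 P.exact₀
  refine (lTensor_exact_iff (f := (P.complex.d 2 1).hom) (g := (P.complex.d 1 0).hom)
    h21 (fun y => ?_) I).trans ?_
  · exact congr($(P.complex.d_comp_d 2 1 0) y)
  let p : P.complex.X 0 →ₗ[C] C ⧸ J := (P.π.f 0).hom
  have hp : Function.Surjective p := (ModuleCat.epi_iff_surjective (P.π.f 0)).1 inferInstance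
  have hker : LinearMap.range (P.complex.d 1 0).hom = LinearMap.ker p := by
    apply le_antisymm
    · rintro _ ⟨x, rfl⟩
      exact congr($(P.complex_d_comp_π_f_zero) x)
    · exact fun x hx => h10 x hx
  have hJ : LinearMap.ker (Submodule.mkQ J) = J := Submodule.ker_mkQ J
  have hI : I • (⊤ : Submodule C C) = I := by simp
  rw [hker]
  constructor
  · intro h
    have := ker_inf_smul_le_of_projective hp (Submodule.mkQ_surjective J) h
    rwa [hJ, hI, smul_eq_mul, inf_comm] at this
  · intro h
    refine ker_inf_smul_le_of_projective (Submodule.mkQ_surjective J) hp ?_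
    rwa [hJ, hI, smul_eq_mul, inf_comm]

/-- The equality `I ∩ J = I J` for all `J` is controlled by finitely many primes. -/
theorem exists_primes_inf_le_mul [IsNoetherianRing C] (J : Ideal C) :
    ∃ Ps : Set (Ideal C), Ps.Finite ∧ (∀ p ∈ Ps, p.IsPrime) ∧
      ∀ I : Ideal C, (∀ p ∈ Ps, I ⊓ p ≤ I * p) → I ⊓ J ≤ I * J := by
  refine IsNoetherian.induction (P := fun J : Ideal C => ∃ Ps : Set (Ideal C), Ps.Finite ∧
    (∀ p ∈ Ps, p.IsPrime) ∧ ∀ I : Ideal C, (∀ p ∈ Ps, I ⊓ p ≤ I * p) → I ⊓ J ≤ I * J) ?_ J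
  intro J ih
  by_cases hJ : J = ⊤
  · exact ⟨∅, Set.finite_empty, by simp, fun I _ => by simp [hJ]⟩
  have : Nontrivial (C ⧸ J) := Ideal.Quotient.nontrivial_iff.2 hJ
  -- Start a prime filtration of `C ⧸ J`: with p = (J : a), the quotient of J + (a) by J is C/p, and
  -- the induction continues at J + (a).
  obtain ⟨p, hp⟩ := associatedPrimes.nonempty C (C ⧸ J)
  obtain ⟨hprime, x, hx⟩ := isAssociatedPrime_iff.1 hp
  obtain ⟨a, rfl⟩ := Ideal.Quotient.mk_surjective x
  have hpa : ∀ c, c ∈ p ↔ c * a ∈ J := by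
    intro c
    rw [hx, Submodule.mem_colon_singleton, Submodule.mem_bot, ← Ideal.Quotient.eq_zero_iff_mem,
      map_mul]
    rfl
  have haJ : a ∉ J := fun h => hprime.ne_top ((Ideal.eq_top_iff_one p).2
    ((hpa 1).2 (by rwa [one_mul])))
  obtain ⟨Ps, hPs, hprimes, h⟩ := ih (J ⊔ Ideal.span {a}) (lt_of_le_of_ne le_sup_left fun heq =>
    haJ (heq ▸ (le_sup_right : _ ≤ J ⊔ Ideal.span {a}) (Ideal.mem_span_singleton_self a)))
  refine ⟨insert p Ps, hPs.insert p, ?_, fun I hI => ?_⟩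
  · rintro q (rfl | hq)
    exacts [hprime, hprimes q hq]
  rintro y ⟨hyI, hyJ⟩
  have h1 := h I (fun q hq => hI q (Set.mem_insert_of_mem _ hq))
    ⟨hyI, (le_sup_left : J ≤ J ⊔ Ideal.span {a}) hyJ⟩
  rw [Ideal.mul_sup] at h1
  obtain ⟨z, hz, w, hw, rfl⟩ := Submodule.mem_sup.1 h1
  obtain ⟨i, hi, rfl⟩ := Ideal.mem_mul_span_singleton.1 hw
  refine Submodule.add_mem _ hz ?_
  -- From z + ia ∈ J and z ∈ IJ follows ia ∈ J, so i ∈ I ∩ p = Ip and ia ∈ Ipa ≤ IJ.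
  have hip : i ∈ I * p := hI p (Set.mem_insert _ _)
    ⟨hi, (hpa i).2 ((Submodule.add_mem_iff_right J (Ideal.mul_le_right hz)).1 hyJ)⟩
  have h2 := Ideal.mul_mem_mul hip (Ideal.mem_span_singleton_self a)
  rw [mul_assoc] at h2
  refine Ideal.mul_mono le_rfl ?_ h2
  rw [Ideal.mul_le]
  intro c hc d hd
  obtain ⟨d, rfl⟩ := Ideal.mem_span_singleton'.1 hd
  rw [mul_left_comm]
  exact Ideal.mul_mem_left J d ((hpa c).1 hc)

end Tor

/-! ### Polycyclic series and complementary subgroups. -/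

section Groups

variable {C G : Type*} [CommRing C] [Group G]

theorem Step.of_isCyclic {S' S : Subgroup G} (hle : S' ≤ S) [(S'.subgroupOf S).Normal]
    [IsCyclic (S ⧸ S'.subgroupOf S)] : Step S' S := by
  refine ⟨hle, ?_⟩
  rcases finite_or_infinite (S ⧸ S'.subgroupOf S) with hfin | hinf
  · exact Or.inl (Subgroup.index_ne_zero_of_finite (H := S'.subgroupOf S))
  · right
    classical
    let e := (intCyclicMulEquiv (G := S ⧸ S'.subgroupOf S)).symm
    let δ : S →* Multiplicative ℤ := e.toMonoidHom.comp (QuotientGroup.mk' _)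
    refine ⟨fun x => if hx : x ∈ S then (δ ⟨x, hx⟩).toAdd else 0, fun x hx y hy => ?_,
      fun x hx => ?_⟩
    · beta_reduce
      rw [dif_pos hx, dif_pos hy, dif_pos (S.mul_mem hx hy), ← toAdd_mul, ← map_mul]
      rfl
    · beta_reduce
      rw [dif_pos hx, toAdd_eq_zero]
      simp only [δ, MonoidHom.comp_apply, QuotientGroup.mk'_apply, MulEquiv.toMonoidHom_eq_coe,
        MonoidHom.coe_coe, EmbeddingLike.map_eq_one_iff]
      rw [QuotientGroup.eq_one_iff, Subgroup.mem_subgroupOf]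

theorem Step.map {G' : Type*} [Group G'] {f : G →* G'} (hf : Function.Injective f)
    {S' S : Subgroup G} (h : Step S' S) : Step (S'.map f) (S.map f) := by
  obtain ⟨hle, h⟩ := h
  refine ⟨Subgroup.map_mono hle, h.imp (fun h => ?_) ?_⟩
  · rwa [Subgroup.relIndex_map_map_of_injective _ _ hf]
  · rintro ⟨δ, hadd, hker⟩
    refine ⟨Function.extend f δ 0, ?_, ?_⟩
    · rintro _ ⟨x, hx, rfl⟩ _ ⟨y, hy, rfl⟩
      rw [← map_mul, hf.extend_apply, hf.extend_apply, hf.extend_apply]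
      exact hadd x hx y hy
    · rintro _ ⟨x, hx, rfl⟩
      rw [hf.extend_apply, hker x hx, Subgroup.mem_map_iff_mem hf]

theorem Step.inf {S' S : Subgroup G} (h : Step S' S) (K : Subgroup G) :
    Step (S' ⊓ K) (S ⊓ K) := by
  obtain ⟨hle, h⟩ := h
  refine ⟨inf_le_inf_right _ hle, h.imp (fun h => ?_) ?_⟩
  · have h1 : S' ⊓ K = S' ⊓ (S ⊓ K) := by rw [← inf_assoc, inf_eq_left.2 hle]
    rw [h1, Subgroup.inf_relIndex_right]
    exact mt (Subgroup.relIndex_eq_zero_of_le_right inf_le_left) h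
  · rintro ⟨δ, hadd, hker⟩
    exact ⟨δ, fun x hx y hy => hadd x hx.1 y hy.1, fun x hx =>
      (hker x hx.1).trans ⟨fun h => ⟨h, hx.2⟩, fun h => h.1⟩⟩

theorem reflTransGen_step_of_isPolycyclic (h : IsPolycyclic G) :
    Relation.ReflTransGen Step (⊥ : Subgroup G) ⊤ := by
  obtain ⟨n, s, h0, hn, hs⟩ := h
  have : ∀ i ≤ n, Relation.ReflTransGen Step (⊥ : Subgroup G) (s i) := by
    intro i
    induction i with
    | zero => exact fun _ => h0 ▸ .refl
    | succ i ih =>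
      intro hi
      obtain ⟨hle, hnorm, hcyc⟩ := hs i hi
      exact (ih (by omega)).tail (Step.of_isCyclic hle)
  exact hn ▸ this n le_rfl

theorem reflTransGen_step_of_isPolycyclicByFinite (h : IsPolycyclicByFinite G) :
    Relation.ReflTransGen Step (⊥ : Subgroup G) ⊤ := by
  obtain ⟨N, -, hfin, hN⟩ := h
  have h1 : Relation.ReflTransGen Step ((⊥ : Subgroup N).map N.subtype)
      ((⊤ : Subgroup N).map N.subtype) :=
    (reflTransGen_step_of_isPolycyclic hN).lift (fun S => S.map N.subtype)
      fun _ _ h => h.map N.subtype_injective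
  simp only [Subgroup.map_bot, ← MonoidHom.range_eq_map, Subgroup.range_subtype] at h1
  exact h1.tail ⟨le_top, Or.inl (by rw [Subgroup.relIndex_top_right]; exact hfin.index_ne_zero)⟩

theorem reflTransGen_step_subgroup (h : IsPolycyclicByFinite G) (K : Subgroup G) :
    Relation.ReflTransGen Step (⊥ : Subgroup G) K := by
  have h1 : Relation.ReflTransGen Step (⊥ ⊓ K) (⊤ ⊓ K) :=
    (reflTransGen_step_of_isPolycyclicByFinite h).lift (fun S => S ⊓ K) fun _ _ h => h.inf K
  simpa using h1

variable [MulSemiringAction G C]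

/-- Write g = k⁻¹a⁻¹x with `x` from a finite set of coset representatives of `HK`. As `k` fixes `I`,
the condition on `g` becomes one on aI and xJ, and then on aI and one of finitely many primes
attached to xJ. -/
theorem exists_finite_of_isComplementary [IsNoetherianRing C] {H K : Subgroup G}
    (hHK : IsComplementary H K) {I : Ideal C} (hI : ∀ k ∈ K, k • I = I)
    (hfin : ∀ p : Ideal C, p.IsPrime → {a | a ∈ H ∧ ¬ a⁻¹ • I ⊓ p ≤ a⁻¹ • I * p}.Finite)
    (J : Ideal C) : ∃ F : Set G, F.Finite ∧ ∀ g : G, ¬ I ⊓ g • J ≤ I * g • J →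
      ∃ f ∈ F, ∃ k ∈ K, g = k * f := by
  obtain ⟨-, L, hL, hLfin⟩ := hHK
  obtain ⟨-, X, hX, hcov⟩ := cofin_univ.of_relIndex (S' := L) le_top
    (by rw [Subgroup.relIndex_top_right]; exact hLfin.index_ne_zero)
  choose Ps hPs hprime h using fun J : Ideal C => exists_primes_inf_le_mul J
  refine ⟨⋃ x ∈ X, ⋃ p ∈ Ps (x • J), (· * x) '' {a | a ∈ H ∧ ¬ a⁻¹ • I ⊓ p ≤ a⁻¹ • I * p},
    hX.biUnion fun x _ => (hPs _).biUnion' fun p hp => (hfin p (hprime _ p hp)).image _,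
    fun g hg => ?_⟩
  obtain ⟨x, hx, l, hl, rfl⟩ := hcov g trivial
  have hl' : l⁻¹ ∈ (L : Set G) := L.inv_mem hl
  rw [hL] at hl'
  obtain ⟨a, ha, k, hk, hak⟩ := hl'
  have hlk : l = k⁻¹ * a⁻¹ := by rw [← mul_inv_rev, ← inv_inv l]; exact congrArg _ hak.symm
  subst hlk
  have hg' : ¬ a • I ⊓ x • J ≤ a • I * x • J := by
    intro hcon
    apply hg
    rw [mul_smul (k⁻¹ * a⁻¹), ← inf_le_mul_smul_iff, mul_inv_rev, inv_inv, inv_inv, mul_smul,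
      hI k hk]
    exact hcon
  obtain ⟨p, hp, hpa⟩ : ∃ p ∈ Ps (x • J), ¬ a • I ⊓ p ≤ a • I * p := by
    by_contra! hcon
    exact hg' (h (x • J) (a • I) hcon)
  refine ⟨a⁻¹ * x, ?_, k⁻¹, K.inv_mem hk, by rw [mul_assoc]⟩
  simp only [Set.mem_iUnion]
  exact ⟨x, hx, p, hp, a⁻¹, ⟨H.inv_mem ha, by rwa [inv_inv]⟩, rfl⟩

theorem torSet_eq (H : Subgroup G) (I J : Ideal C) :
    torSet H I J = {a | a ∈ H ∧ ¬ a⁻¹ • I ⊓ J ≤ a⁻¹ • I * J} := by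
  simp only [torSet, isZero_torOne_iff]

end Groups

/-! ### The idealiser and its left ideals in coordinates. -/

open SkewMonoidAlgebra

variable {C G : Type*} [CommRing C] [Group G] [MulSemiringAction G C]

theorem coeff_single_mul (g : G) (c : C) (b : SkewGroupRing C G) :
    (single g c * b).coeff = c • act g b.coeff := by
  induction b using SkewMonoidAlgebra.induction_on with
  | zero => simp
  | single h d =>
    rw [single_mul_single, coeff_single, coeff_single]
    ext x
    classical
    simp only [Finsupp.single_apply, Finsupp.smul_apply, act_apply, smul_eq_mul,
      eq_inv_mul_iff_mul_eq]
    split_ifs <;> simp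
  | add x y hx hy => rw [mul_add, coeff_add, hx, hy, coeff_add, map_add, smul_add]

/-- A left module structure on coefficient functions: a submodule contains `r * b` as soon as it
contains all terms of the product. -/
theorem coeff_mul_mem {N : Submodule C (G →₀ C)} {r b : SkewGroupRing C G}
    (h : ∀ g, r.coeff g • act g b.coeff ∈ N) : (r * b).coeff ∈ N := by
  have h1 : (r * b).coeff = r.coeff.sum fun g c => c • act g b.coeff := by
    conv_lhs => rw [← sum_single r, sum_mul, sum_def, Finsupp.sum]
    rw [← coeffAddEquiv_apply, _root_.map_sum]
    exact Finset.sum_congr rfl fun g _ => coeff_single_mul g _ b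
  rw [h1]
  exact N.sum_mem fun g _ => h g

theorem mem_extendedRightIdeal {I : Ideal C} {x : SkewGroupRing C G} :
    x ∈ extendedRightIdeal G I ↔ x.coeff ∈ coeffIn I := by
  constructor
  · intro hx
    induction hx using Submodule.span_induction with
    | mem x hx =>
      obtain ⟨c, hc, rfl⟩ := hx
      intro y
      classical
      simp only [coeff_single, Finsupp.single_apply]
      split_ifs
      exacts [hc, I.zero_mem]
    | zero => exact Submodule.zero_mem _
    | add x y _ _ hx hy => rw [coeff_add]; exact Submodule.add_mem _ hx hy
    | smul b x _ hx => exact coeff_mul_mem fun g y => I.mul_mem_right _ (hx g)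
  · intro hx
    rw [← sum_single x, sum_def]
    refine Submodule.sum_mem _ fun g _ => ?_
    have h1 : single g (x.coeff g) =
        MulOpposite.op (single g 1 : SkewGroupRing C G) • single (1 : G) (x.coeff g) := by
      rw [op_smul_eq_mul, single_mul_single]
      simp
    rw [h1]
    exact Submodule.smul_mem _ _ (Submodule.subset_span ⟨_, hx g, rfl⟩)

/-- The chain I ≤ g⁻¹I ≤ g⁻²I ≤ … must stabilise. -/
theorem mem_stabilizer_of_smul_le [IsNoetherianRing C] {I : Ideal C} {g : G} (h : g • I ≤ I) :
    g ∈ MulAction.stabilizer G I := by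
  have hle : I ≤ g⁻¹ • I := by
    rw [← Ideal.pointwise_smul_subset_iff]
    exact h
  have hmono : Monotone fun n : ℕ => (g⁻¹ ^ n) • I := by
    refine monotone_nat_of_le_succ fun n => ?_
    rw [pow_succ, mul_smul]
    exact Ideal.pointwise_smul_le_pointwise_smul_iff.2 hle
  obtain ⟨n, hn⟩ := monotone_stabilizes_iff_noetherian.2 ‹IsNoetherianRing C› ⟨_, hmono⟩
  have h1 : g⁻¹ ^ n • I = g⁻¹ ^ (n + 1) • I := hn (n + 1) n.le_succ
  rw [pow_succ, mul_smul] at h1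
  rw [MulAction.mem_stabilizer_iff, ← eq_inv_smul_iff]
  exact smul_left_cancel _ h1

theorem smul_of_mem_stabilizer {I : Ideal C} : ∀ k ∈ MulAction.stabilizer G I, k • I = I :=
  fun _ hk => hk

variable (G) in
/-- The idealiser of the right ideal of the skew group ring generated by `I`. -/
noncomputable def skewIdealiser (I : Ideal C) : Subring (SkewGroupRing C G) :=
  idealiser (B := SkewGroupRing C G) (extendedRightIdeal (C := C) G I)

/-- The idealiser consists of the elements with coefficients in `I` outside the stabilizer. -/
theorem mem_idealiser [IsNoetherianRing C] {I : Ideal C} (hI : I.IsPrime)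
    {r : SkewGroupRing C G} : r ∈ skewIdealiser G I ↔
      ∀ g, g ∈ MulAction.stabilizer G I ∨ r.coeff g ∈ I := by
  constructor
  · intro hr g
    by_contra! hcon
    -- For `x ∈ I`, the coefficient of `r * x` at `g` is `r.coeff g * g • x`; primality puts `g • x`
    -- in `I`.
    refine hcon.1 (mem_stabilizer_of_smul_le fun y hy => ?_)
    obtain ⟨x, rfl⟩ : ∃ x, y = g • x := ⟨g⁻¹ • y, by simp⟩
    rw [Ideal.smul_mem_pointwise_smul_iff] at hy
    have h1 := mem_extendedRightIdeal.1 (hr (single 1 x) (Submodule.subset_span ⟨x, hy, rfl⟩)) g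
    have h2 : (r * single 1 x).coeff g = r.coeff g * g • x := by
      exact coeff_mul_single_aux r (by simp)
    rw [h2] at h1
    exact (hI.mem_or_mem h1).resolve_left hcon.2
  · intro hr x hx
    rw [mem_extendedRightIdeal] at hx ⊢
    refine coeff_mul_mem fun g => ?_
    rcases hr g with hg | hg
    · have := act_mem_coeffIn g hx
      rw [smul_of_mem_stabilizer g hg] at this
      exact Submodule.smul_mem _ _ this
    · exact fun y => I.mul_mem_right _ hg

section Coefficients

variable {I : Ideal C}

theorem single_mem_idealiser [IsNoetherianRing C] (hI : I.IsPrime) {g : G} {c : C}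
    (h : g ∈ MulAction.stabilizer G I ∨ c ∈ I) :
    (single g c : SkewGroupRing C G) ∈ skewIdealiser G I := by
  classical
  refine (mem_idealiser hI).2 fun g' => ?_
  rw [coeff_single, Finsupp.single_apply]
  split_ifs with hg
  · exact hg ▸ h
  · exact Or.inr I.zero_mem

/-- The coefficient functions of the elements of a left ideal of the idealiser. -/
def coeffSubmodule [IsNoetherianRing C] (hI : I.IsPrime)
    (N : Ideal (skewIdealiser G I)) : Submodule C (G →₀ C) where
  carrier := {f | ∃ r ∈ N, (r : SkewGroupRing C G).coeff = f}
  add_mem' := by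
    rintro _ _ ⟨r, hr, rfl⟩ ⟨r', hr', rfl⟩
    exact ⟨r + r', N.add_mem hr hr', by rw [Subring.coe_add, coeff_add]⟩
  zero_mem' := ⟨0, N.zero_mem, by rw [Subring.coe_zero, coeff_zero]⟩
  smul_mem' := by
    rintro c _ ⟨r, hr, rfl⟩
    let s : skewIdealiser G I :=
      ⟨single 1 c, single_mem_idealiser hI (Or.inl (Subgroup.one_mem _))⟩
    refine ⟨s * r, N.mul_mem_left s hr, ?_⟩
    rw [Subring.coe_mul, coeff_single_mul, act_one]

variable [IsNoetherianRing C]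

theorem le_of_coeffSubmodule_le (hI : I.IsPrime)
    {N N' : Ideal (skewIdealiser G I)}
    (h : coeffSubmodule hI N ≤ coeffSubmodule hI N') : N ≤ N' := by
  intro r hr
  obtain ⟨r', hr', hrr'⟩ := h ⟨r, hr, rfl⟩
  rw [coeff_inj] at hrr'
  rwa [← Subtype.ext hrr']

theorem smul_act_mem_coeffSubmodule (hI : I.IsPrime)
    {N : Ideal (skewIdealiser G I)} {g : G} {c : C}
    (h : g ∈ MulAction.stabilizer G I ∨ c ∈ I) {f : G →₀ C} (hf : f ∈ coeffSubmodule hI N) :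
    c • act g f ∈ coeffSubmodule hI N := by
  obtain ⟨r, hr, rfl⟩ := hf
  let s : skewIdealiser G I := ⟨single g c, single_mem_idealiser hI h⟩
  refine ⟨s * r, N.mul_mem_left s hr, ?_⟩
  rw [Subring.coe_mul, coeff_single_mul]

theorem stable_coeffSubmodule (hI : I.IsPrime)
    (N : Ideal (skewIdealiser G I)) :
    Stable (MulAction.stabilizer G I) (coeffSubmodule hI N) := fun k hk f hf => by
  simpa using smul_act_mem_coeffSubmodule hI (c := 1) (Or.inl hk) hf

/-- Elements `single g i` with `i ∈ I` belong to the idealiser for every `g`, not only for `g` in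
the stabilizer. -/
theorem smul_gen_le_coeffSubmodule (hI : I.IsPrime)
    {N : Ideal (skewIdealiser G I)} {X : Set (G →₀ C)}
    (hX : X ⊆ coeffSubmodule hI N) : I • gen ⊤ X ≤ coeffSubmodule hI N := by
  refine Submodule.smul_le.2 fun i hi l hl => ?_
  induction hl using Submodule.span_induction with
  | mem x hx =>
    obtain ⟨g, -, x, hx, rfl⟩ := hx
    exact smul_act_mem_coeffSubmodule hI (Or.inr hi) (hX hx)
  | zero => rw [smul_zero]; exact Submodule.zero_mem _
  | add x y _ _ hx hy => rw [smul_add]; exact Submodule.add_mem _ hx hy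
  | smul c x _ hx => rw [smul_comm]; exact Submodule.smul_mem _ _ hx

theorem mem_coeffIn_of_res_eq_zero (hI : I.IsPrime)
    {N : Ideal (skewIdealiser G I)} {f : G →₀ C} (hf : f ∈ coeffSubmodule hI N)
    (h : res (MulAction.stabilizer G I : Set G) f = 0) : f ∈ coeffIn I := by
  obtain ⟨r, -, rfl⟩ := hf
  intro g
  rcases (mem_idealiser hI).1 r.2 g with hg | hg
  · have := DFunLike.congr_fun h g
    rw [res_apply, if_pos (show g ∈ (MulAction.stabilizer G I : Set G) from hg)] at this
    rw [this]
    exact I.zero_mem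
  · exact hg

end Coefficients

/-- Each of the finitely many generators uses only finitely many elements of `Z`. -/
theorem exists_finite_subset_gen {S : Subgroup G} (hH : Hilbert C S) {Y : Set G} (hY : Cofin S Y)
    {Z : Set (G →₀ C)} (hZ : gen S Z ≤ Finsupp.supported C C Y) :
    ∃ X : Set (G →₀ C), X.Finite ∧ X ⊆ Z ∧ gen S Z ≤ gen S X := by
  obtain ⟨X, hX, hXZ, h⟩ := hH Y hY _ hZ (stable_gen S Z)
  have key : ∀ x ∈ gen S Z, ∃ W : Set (G →₀ C), W.Finite ∧ W ⊆ Z ∧ x ∈ gen S W := by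
    intro x hx
    induction hx using Submodule.span_induction with
    | mem x hx =>
      obtain ⟨s, hs, z, hz, rfl⟩ := hx
      exact ⟨{z}, Set.finite_singleton z, Set.singleton_subset_iff.2 hz, act_mem_gen hs rfl⟩
    | zero => exact ⟨∅, Set.finite_empty, Set.empty_subset _, Submodule.zero_mem _⟩
    | add x y _ _ hx hy =>
      obtain ⟨W, hW, hWZ, hx⟩ := hx
      obtain ⟨W', hW', hWZ', hy⟩ := hy
      exact ⟨W ∪ W', hW.union hW', Set.union_subset hWZ hWZ', Submodule.add_mem _
        (gen_mono le_rfl Set.subset_union_left hx) (gen_mono le_rfl Set.subset_union_right hy)⟩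
    | smul c x _ hx =>
      obtain ⟨W, hW, hWZ, hx⟩ := hx
      exact ⟨W, hW, hWZ, Submodule.smul_mem _ _ hx⟩
  choose! W hW hWZ hxW using key
  refine ⟨⋃ x ∈ X, W x, hX.biUnion fun x hx => hW x (hXZ hx),
    Set.iUnion₂_subset fun x hx => hWZ x (hXZ hx), h.trans (gen_le (stable_gen _ _) fun x hx => ?_)⟩
  exact gen_mono le_rfl (Set.subset_biUnion_of_mem hx) (hxW x (hXZ hx))

theorem cofin_self (K : Subgroup G) : Cofin K (K : Set G) :=
  ⟨fun _ hs _ hy => K.mul_mem hs hy, {1}, Set.finite_singleton 1,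
    fun y hy => ⟨1, rfl, y, hy, by simp⟩⟩

/-- `X₁` generates BP, `X₂` generates P ∩ IB modulo I·BP, and `X₃` generates the restriction of `P`
to `K`. Subtracting a lift of the restriction leaves an element of P ∩ IB, which `X₂` and I·gen(X₁)
account for. -/
theorem isNoetherianRing_idealiser [IsNoetherianRing C] (hG : IsPolycyclicByFinite G)
    {I : Ideal C} (hI : I.IsPrime)
    (hstar : ∀ J : Ideal C, ∃ F : Set G, F.Finite ∧ ∀ g : G, ¬ I ⊓ g • J ≤ I * g • J →
      ∃ f ∈ F, ∃ k ∈ MulAction.stabilizer G I, g = k * f) :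
    IsNoetherianRing (skewIdealiser G I) := by
  let K := MulAction.stabilizer G I
  refine (isNoetherianRing_iff_ideal_fg _).2 fun N => ?_
  let P := coeffSubmodule hI N
  have huniv : ∀ N : Submodule C (G →₀ C), N ≤ Finsupp.supported C C Set.univ := by simp
  have hP : Stable K P := stable_coeffSubmodule hI N
  obtain ⟨X₁, hX₁, hXP₁, h₁⟩ := exists_finite_subset_gen
    (hilbert_of_reflTransGen (reflTransGen_step_subgroup hG ⊤)) cofin_univ
    (Z := (P : Set (G →₀ C))) (huniv _)
  obtain ⟨X₂, hX₂, hXP₂, h₂⟩ := relNoeth_of_reflTransGen (K := K) smul_of_mem_stabilizer hstar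
    (reflTransGen_step_subgroup hG ⊤) Set.univ cofin_univ (gen ⊤ (P : Set (G →₀ C))) (huniv _)
    (stable_gen _ _) (P ⊓ coeffIn I)
    (le_inf (smul_gen_le_coeffSubmodule hI subset_rfl) (smul_le_coeffIn _ _))
    (inf_le_inf_right _ (subset_gen _ _)) (by
      intro k hk x hx
      have := act_mem_coeffIn k hx.2
      rw [smul_of_mem_stabilizer k hk.1] at this
      exact ⟨hP k hk.1 x hx.1, this⟩)
  have hstab : ∀ M : Submodule C (G →₀ C), Stable K M → Stable K (M.map (res (K : Set G))) := by
    rintro M hM k hk _ ⟨x, hx, rfl⟩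
    rw [act_res (A' := (K : Set G)) fun y => K.mul_mem_cancel_left hk]
    exact ⟨_, hM k hk x hx, rfl⟩
  obtain ⟨X₃, hX₃, hXP₃, h₃⟩ := hilbert_of_reflTransGen (C := C) (reflTransGen_step_subgroup hG K)
    (K : Set G) (cofin_self K) (P.map (res (K : Set G)))
    (by rintro _ ⟨x, -, rfl⟩; exact res_mem_supported _ _) (hstab P hP)
  have hlifts : ∀ x ∈ X₃, ∃ y ∈ P, res (K : Set G) y = x := hXP₃
  choose! lift hlift hres using hlifts
  let X := X₁ ∪ X₂ ∪ lift '' X₃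
  have hX : X.Finite := (hX₁.union hX₂).union (hX₃.image lift)
  have hXP : X ⊆ P := by
    refine Set.union_subset (Set.union_subset hXP₁ fun x hx => (hXP₂ hx).1) ?_
    rintro _ ⟨x, hx, rfl⟩
    exact hlift x hx
  let T : Set (skewIdealiser G I) :=
    {r | r ∈ N ∧ (r : SkewGroupRing C G).coeff ∈ X}
  have hT : T.Finite := by
    refine Set.Finite.subset (hX.preimage (f := fun r : skewIdealiser G I =>
      (r : SkewGroupRing C G).coeff) fun r _ r' _ h => ?_) fun r hr => hr.2
    exact Subtype.ext (coeff_injective h)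
  have hTN : Ideal.span T ≤ N := Ideal.span_le.2 fun r hr => hr.1
  refine Submodule.fg_def.2 ⟨T, hT, le_antisymm hTN (le_of_coeffSubmodule_le hI ?_)⟩
  let P' := coeffSubmodule hI (Ideal.span T)
  change P ≤ P'
  have hP' : Stable K P' := stable_coeffSubmodule hI _
  have hXP' : X ⊆ P' := by
    intro x hx
    obtain ⟨r, hr, rfl⟩ := hXP hx
    exact ⟨r, Ideal.subset_span ⟨hr, hx⟩, rfl⟩
  have hle : P' ≤ P := by
    rintro _ ⟨r, hr, rfl⟩
    exact ⟨r, hTN hr, rfl⟩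
  intro f hf
  have h4 : res (K : Set G) f ∈ P'.map (res (K : Set G)) := by
    refine h₃.trans (gen_le (hstab P' hP') fun x hx => ?_) ⟨f, hf, rfl⟩
    exact ⟨lift x, hXP' (Or.inr ⟨x, hx, rfl⟩), hres x hx⟩
  obtain ⟨f', hf', hff'⟩ := h4
  have h5 : f - f' ∈ P := P.sub_mem hf (hle hf')
  have h6 : f - f' ∈ coeffIn I :=
    mem_coeffIn_of_res_eq_zero hI h5 (by rw [map_sub, hff', sub_self])
  have h7 : f - f' ∈ P' := by
    refine (h₂.trans (sup_le ?_ ?_)) ⟨h5, h6⟩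
    · exact gen_le (hP'.mono inf_le_left) fun x hx => hXP' (Or.inl (Or.inr hx))
    · exact (Submodule.smul_mono le_rfl h₁).trans
        (smul_gen_le_coeffSubmodule hI fun x hx => hXP' (Or.inl (Or.inl hx)))
  rw [← sub_add_cancel f f']
  exact P'.add_mem h7 hf'

/-! ### The left ideals that detect Tor, and the equivalence. -/

/-- Elements whose coefficient at `h` lies in `I ∩ h • J`, and in `I (h • J)` for `h` outside a
union of cosets of the stabilizer of `I`. -/
def cosetSubmodule (I J : Ideal C) (S : Set G) : Submodule C (G →₀ C) where
  carrier := {f | ∀ h, f h ∈ I ⊓ h • J ∧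
    ((∃ k ∈ MulAction.stabilizer G I, ∃ s ∈ S, h = k * s) ∨ f h ∈ I * h • J)}
  add_mem' hr hr' h := by
    refine ⟨Ideal.add_mem _ (hr h).1 (hr' h).1, ?_⟩
    rcases (hr h).2 with h1 | h1
    · exact Or.inl h1
    · exact (hr' h).2.imp_right (Ideal.add_mem _ h1)
  zero_mem' h := ⟨Ideal.zero_mem _, Or.inr (Ideal.zero_mem _)⟩
  smul_mem' c f hf h :=
    ⟨Ideal.mul_mem_left _ c (hf h).1, (hf h).2.imp_right (Ideal.mul_mem_left _ c)⟩

/-- The elements of the idealiser with coefficient function in `cosetSubmodule I J S`. -/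
def cosetIdeal [IsNoetherianRing C] {I : Ideal C} (hI : I.IsPrime) (J : Ideal C) (S : Set G) :
    Ideal (skewIdealiser G I) where
  carrier := {r | (r : SkewGroupRing C G).coeff ∈ cosetSubmodule I J S}
  add_mem' {a b} ha hb := by
    rw [Set.mem_ofPred_eq, Subring.coe_add, coeff_add]
    exact Submodule.add_mem _ ha hb
  zero_mem' := Submodule.zero_mem (cosetSubmodule I J S)
  smul_mem' r x hx := by
    rw [Set.mem_ofPred_eq, smul_eq_mul, Subring.coe_mul]
    refine coeff_mul_mem fun g h => ?_
    rw [Finsupp.smul_apply, act_apply, smul_eq_mul]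
    obtain ⟨⟨h1, h2⟩, h3⟩ := hx (g⁻¹ * h)
    have h2 := Ideal.smul_mem_pointwise_smul g _ _ h2
    rw [smul_smul, mul_inv_cancel_left] at h2
    -- For `g` in the stabilizer, `I` and the cosets are preserved; otherwise `r.coeff g ∈ I` and
    -- the product lands in `I * h • J`.
    rcases (mem_idealiser hI).1 r.2 g with hg | hg
    · have h1 := Ideal.smul_mem_pointwise_smul g _ _ h1
      rw [smul_of_mem_stabilizer g hg] at h1
      refine ⟨Ideal.mul_mem_left _ _ ⟨h1, h2⟩, h3.imp ?_ fun h3 => ?_⟩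
      · rintro ⟨k, hk, s, hs, hks⟩
        exact ⟨g * k, Subgroup.mul_mem _ hg hk, s, hs, by rw [mul_assoc, ← hks]; group⟩
      · have := Ideal.smul_mem_pointwise_smul g _ _ h3
        rw [smul_mul', smul_smul, mul_inv_cancel_left, smul_of_mem_stabilizer g hg] at this
        exact Ideal.mul_mem_left _ _ this
    · exact ⟨⟨Ideal.mul_mem_right _ _ hg, Ideal.mul_mem_left _ _ h2⟩,
        Or.inr (Ideal.mul_mem_mul hg h2)⟩

theorem finite_of_isNoetherianRing_idealiser [IsNoetherianRing C] {I : Ideal C} (hI : I.IsPrime)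
    (hR : IsNoetherianRing (skewIdealiser G I)) {H : Subgroup G}
    (hH : H ⊓ MulAction.stabilizer G I = ⊥) (J : Ideal C) :
    {a | a ∈ H ∧ ¬ a⁻¹ • I ⊓ J ≤ a⁻¹ • I * J}.Finite := by
  obtain ⟨T, hT⟩ := (isNoetherianRing_iff_ideal_fg _).1 hR (cosetIdeal hI J Set.univ)
  let S : Set G := ⋃ r ∈ T, ((r : SkewGroupRing C G).coeff.support : Set G)
  have hS : S.Finite := T.finite_toSet.biUnion fun r _ => Finset.finite_toSet _
  -- The generators vanish off `S`, so they lie in the smaller left ideal.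
  have hN : cosetIdeal hI J Set.univ ≤ cosetIdeal hI J S := by
    rw [← hT]
    refine Submodule.span_le.2 fun r hr h => ?_
    have hrN : r ∈ cosetIdeal hI J Set.univ := hT ▸ Submodule.subset_span hr
    refine ⟨(hrN h).1, ?_⟩
    by_cases h0 : (r : SkewGroupRing C G).coeff h = 0
    · exact Or.inr (h0 ▸ Ideal.zero_mem _)
    · exact Or.inl ⟨1, Subgroup.one_mem _, h,
        Set.mem_biUnion hr (Finsupp.mem_support_iff.2 h0), by simp⟩
  have hbad : ∀ a, a ∈ H ∧ ¬ a⁻¹ • I ⊓ J ≤ a⁻¹ • I * J →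
      ∃ s ∈ S, ∃ k ∈ MulAction.stabilizer G I, a = k * s := by
    rintro a ⟨-, ha⟩
    rw [inf_le_mul_smul_iff, SetLike.not_le_iff_exists] at ha
    obtain ⟨c, hc, hca⟩ := ha
    let r : skewIdealiser G I :=
      ⟨single a c, single_mem_idealiser hI (Or.inr hc.1)⟩
    classical
    have hr : r ∈ cosetIdeal hI J Set.univ := by
      refine fun h => ⟨?_, Or.inl ⟨1, Subgroup.one_mem _, h, trivial, by simp⟩⟩
      change (Finsupp.single a c) h ∈ I ⊓ h • J
      rw [Finsupp.single_apply]
      split_ifs with hah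
      exacts [hah ▸ hc, Ideal.zero_mem _]
    rcases (hN hr a).2 with ⟨k, hk, s, hs, h⟩ | h
    · exact ⟨s, hs, k, hk, h⟩
    · change (Finsupp.single a c) a ∈ _ at h
      rw [Finsupp.single_eq_same] at h
      exact absurd h hca
  choose! φ hφ k hk hak using hbad
  refine Set.Finite.of_finite_image (hS.subset (Set.image_subset_iff.2 hφ)) (f := φ) ?_
  intro a ha a' ha' haa'
  -- Elements of `H` in the same coset of the stabilizer differ by an element of the trivial
  -- intersection, so `φ` is injective.
  have h1 : a * a'⁻¹ ∈ H ⊓ MulAction.stabilizer G I := by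
    refine ⟨H.mul_mem ha.1 (H.inv_mem ha'.1), ?_⟩
    have h2 : a * a'⁻¹ = k a * (k a')⁻¹ := by
      conv_lhs => rw [hak a ha, hak a' ha', haa']
      group
    rw [h2]
    exact Subgroup.mul_mem _ (hk a ha) (Subgroup.inv_mem _ (hk a' ha'))
  rw [hH, Subgroup.mem_bot] at h1
  exact mul_inv_eq_one.1 h1

end SkewIdealiser

theorem theoremL {C G : Type*} [CommRing C] [IsDomain C] [IsNoetherianRing C]
    [Group G] (hG : IsPolycyclicByFinite G) [MulSemiringAction G C]
    (I : Ideal C) (hI : I.IsPrime)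
    (hK : ∃ H : Subgroup G, IsComplementary H (MulAction.stabilizer G I)) :
    List.TFAE
      [∃ H : Subgroup G, IsComplementary H (MulAction.stabilizer G I) ∧
          ∀ J : Ideal C, J.IsPrime → (torSet H I J).Finite,
        IsNoetherianRing (idealiser (extendedRightIdeal G I)),
        ∀ H : Subgroup G, IsComplementary H (MulAction.stabilizer G I) →
          ∀ J : Ideal C, J.IsPrime → (torSet H I J).Finite] := by
  simp only [SkewIdealiser.torSet_eq]
  tfae_have 1 → 2 := by
    rintro ⟨H, hH, hfin⟩
    exact SkewIdealiser.isNoetherianRing_idealiser hG hI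
      (SkewIdealiser.exists_finite_of_isComplementary hH SkewIdealiser.smul_of_mem_stabilizer hfin)
  tfae_have 2 → 3 := fun hR H hH J _ =>
    SkewIdealiser.finite_of_isNoetherianRing_idealiser hI hR hH.1 J
  tfae_have 3 → 1 := fun h => hK.imp fun H hH => ⟨hH, h H hH⟩
  tfae_finish
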